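/- Let $D$ be an integral domain with quotient field $K$. An overring of $D$ is a ring $T$ with $D\subseteq T\subseteq K$; put $\sigma(T)=\{Q\cap D\mid Q\in\operatorname{Spec}T\}$. The Zariski topology on the set of overrings has the sets $\{T\mid x_1,\dots,x_n\in T\}$ ($x_i\in K$) as a subbasis. A family $\Theta$ of overrings of $D$ is a pre-Jaffard family of $D$ if (a) $K\notin\Theta$ or $\Theta=\{K\}$; (b) every $T\in\Theta$ is flat over $D$; (c) $\Theta$ is independent, i.e. $\sigma(A)\cap\sigma(B)=\{(0)\}$ for all $A\neq B$ in $\Theta$; (d) $\Theta$ is complete, i.e. $I=\bigcap_{T\in\Theta}IT$ for every ideal $I$ of $D$; (e) $\Theta$ is compact in the Zariski topology. It is a Jaffard family of $D$ if (a)--(d) hold and every nonzero $x\in K$ is a unit in all but finitely many $T\in\Theta$. A Jaffard overring of $D$ is a member of some Jaffard family of $D$. Let $\Theta$ be a pre-Jaffard family of $D$ (for instance, a Jaffard family). Define $T_\alpha$ and $\Theta_\alpha$ for every ordinal $\alpha$ by $T_0=D$, $\Theta_0=\Theta$; $\Theta_{\gamma+1}=\{T\in\Theta_\gamma\mid T\text{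 is not a Jaffard overring of }T_\gamma\}$; $\Theta_\alpha=\bigcap_{\beta<\alpha}\Theta_\beta$ for a limit ordinal $\alpha$; and $T_\alpha=\bigcap_{S\in\Theta_\alpha}S$ for $\alpha>0$, where $T_\alpha=K$ if $\Theta_\alpha=\emptyset$. Fix an ordinal $\alpha$ and let $\Theta'=(\Theta\setminus\Theta_\alpha)\cup\{T_\alpha\}$. A stable semistar operation on a domain $A$ with quotient field $K$ is a map $I\mapsto I^\star$ on the $A$-submodules of $K$ such that $I\subseteq I^\star$; $I\subseteq J$ implies $I^\star\subseteq J^\star$; $(I^\star)^\star=I^\star$; $x\cdot I^\star=(xI)^\star$ for every $x\in K$; and $(I\cap J)^\star=I^\star\cap J^\star$. The set $\mathrm{Stab}(A)$ of these is ordered by $\star_1\le\star_2$ iff $I^{\star_1}\subseteq I^{\star_2}$ for all $I$. A length function on $A$ is a function $\ell$ from $A$-modules to $[0,\infty]$ with $\ell(0)=0$, additive on short exact sequences, and with $\ell(M)=\sup\{\ell(N)\mid N\subseteq M\text{ finitely generated}\}$; it is singular if it takes only the values $0$ and $\infty$. Let $\mathcal L_{\mathrm{sing}}(A)$ be the set of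 the singular length functions on $A$ that are not identically $0$, ordered pointwise. Then: 1. For every $\star\in\mathrm{Stab}(D)$ and every $D$-submodule $I$ of $K$, $I^\star=\bigcap_{T\in\Theta'}(IT)^\star$. 2. The restriction map $\star\mapsto(\star|_{T\text{-submodules of }K})_{T\in\Theta'}$ is an order isomorphism $\mathrm{Stab}(D)\cong\prod_{T\in\Theta'}\mathrm{Stab}(T)$, and its inverse is the extension map, which sends $(\star^{(T)})_{T\in\Theta'}$ to $I\mapsto\bigcap_{T\in\Theta'}(IT)^{\star^{(T)}}$. 3. For every singular length function $\ell$ on $D$ and every $D$-module $M$, $\ell(M)=\sum_{T\in\Theta'}\ell(M\otimes_DT)$. 4. Restriction of scalars, $\ell\mapsto(\ell|_{T\text{-modules}})_{T\in\Theta'}$, is an order isomorphism $\mathcal L_{\mathrm{sing}}(D)\cong\prod_{T\in\Theta'}\mathcal L_{\mathrm{sing}}(T)$, and its inverse sends $(\ell^{(T)})_{T\in\Theta'}$ to $M\mapsto\sum_{T\in\Theta'}\ell^{(T)}(M\otimes_DT)$. -/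

import Mathlib

open scoped Pointwise ENNReal

universe u v

noncomputable section

namespace PreJaffard

/-! Throughout, `K` is a field. A domain with quotient field `K` is given as a subring `A` of `K`
(with `IsFractionRing A K`), and the overrings of `A` are the subrings `T` of `K` with `A ≤ T`. -/

section Families

variable {K : Type u} [Field K]

/-- `T` is an overring of `A` that is flat as an `A`-module. -/
def IsFlatOverring (A T : Subring K) : Prop :=
  ∃ h : A ≤ T, (Subring.inclusion h).Flat

/-- The set `σ(T)` of the primes `Q ∩ A` of `A`, where `Q` ranges over the primes of `T`. -/
def contractions (A T : Subring K) : Set (PrimeSpectrum A) :=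
  {P | ∃ Q : PrimeSpectrum T,
    (Subtype.val '' (P.asIdeal : Set A) : Set K) =
      (Subtype.val '' (Q.asIdeal : Set T)) ∩ (A : Set K)}

/-- `Θ` is complete: `I = ⋂ {IT | T ∈ Θ}` for every ideal `I` of `A`. -/
def IsComplete (A : Subring K) (Θ : Set (Subring K)) : Prop :=
  ∀ I : Ideal A, (Subtype.val '' (I : Set A) : Set K) =
    ⋂ T ∈ Θ, (Submodule.span T (Subtype.val '' (I : Set A) : Set K) : Set K)

/-- `Θ` is independent: distinct members have only the zero prime in common. -/
def IsIndependent (A : Subring K) (Θ : Set (Subring K)) : Prop :=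
  ∀ S ∈ Θ, ∀ T ∈ Θ, S ≠ T → ∀ P : PrimeSpectrum A,
    P ∈ contractions A S ∩ contractions A T ↔ P.asIdeal = ⊥

/-- `Θ` is locally finite: each nonzero `x ∈ K` is a unit in all but finitely many members. -/
def IsLocallyFinite (Θ : Set (Subring K)) : Prop :=
  ∀ x : K, x ≠ 0 → {T ∈ Θ | ¬ (x ∈ T ∧ x⁻¹ ∈ T)}.Finite

variable (K) in
/-- The Zariski topology on the subrings of `K`, with the sets `{T | x₁, …, xₙ ∈ T}` as a subbasis.
It induces the Zariski topology on the set of overrings of each subring. -/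
@[reducible]
def zariskiTopology : TopologicalSpace (Subring K) :=
  TopologicalSpace.generateFrom {U | ∃ F : Finset K, U = {T : Subring K | (F : Set K) ⊆ (T : Set K)}}

/-- `Θ` is a Jaffard family of `A`. -/
structure IsJaffardFamily (A : Subring K) (Θ : Set (Subring K)) : Prop where
  top_notMem_or : ⊤ ∉ Θ ∨ Θ = {⊤}
  flat : ∀ T ∈ Θ, IsFlatOverring A T
  complete : IsComplete A Θ
  independent : IsIndependent A Θ
  locallyFinite : IsLocallyFinite Θ

/-- `T` is a Jaffard overring of `A`: it belongs to some Jaffard family of `A`. -/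
def IsJaffardOverring (A T : Subring K) : Prop :=
  ∃ Θ : Set (Subring K), IsJaffardFamily A Θ ∧ T ∈ Θ

/-- `Θ` is a pre-Jaffard family of `A`. -/
structure IsPreJaffardFamily (A : Subring K) (Θ : Set (Subring K)) : Prop where
  top_notMem_or : ⊤ ∉ Θ ∨ Θ = {⊤}
  flat : ∀ T ∈ Θ, IsFlatOverring A T
  independent : IsIndependent A Θ
  complete : IsComplete A Θ
  compact : @IsCompact _ (zariskiTopology K) Θ

/-- The pairs `(T_α, Θ_α)`, by transfinite recursion. The intersection of the empty family is
`sInf ∅ = ⊤`, that is, `K`. -/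
def derivedPair (A : Subring K) (Θ : Set (Subring K)) (α : Ordinal.{v}) :
    Subring K × Set (Subring K) :=
  Ordinal.limitRecOn α (A, Θ)
    (fun _ p => (sInf (p.2 \ {T | IsJaffardOverring p.1 T}), p.2 \ {T | IsJaffardOverring p.1 T}))
    (fun β _ p => (sInf (⋂ (γ) (h : γ < β), (p γ h).2), ⋂ (γ) (h : γ < β), (p γ h).2))

/-- The ring `T_α` of the derived sequence of `Θ`. -/
def derivedRing (A : Subring K) (Θ : Set (Subring K)) (α : Ordinal.{v}) : Subring K :=
  (derivedPair A Θ α).1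

/-- The subfamily `Θ_α` of `Θ`. -/
def derivedFamily (A : Subring K) (Θ : Set (Subring K)) (α : Ordinal.{v}) : Set (Subring K) :=
  (derivedPair A Θ α).2

/-- The family `Θ' = (Θ \ Θ_α) ∪ {T_α}`. -/
def truncation (A : Subring K) (Θ : Set (Subring K)) (α : Ordinal.{v}) : Set (Subring K) :=
  (Θ \ derivedFamily A Θ α) ∪ {derivedRing A Θ α}

theorem derived_subset_and_le (A : Subring K) (Θ : Set (Subring K)) (hA : ∀ T ∈ Θ, A ≤ T)
    (α : Ordinal.{v}) : derivedFamily A Θ α ⊆ Θ ∧ A ≤ derivedRing A Θ α := by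
  unfold derivedFamily derivedRing
  induction α using Ordinal.limitRecOn with
  | zero => simp [derivedPair]
  | add_one β ih =>
    have h : (derivedPair A Θ (β + 1)).2 ⊆ Θ := by
      simp only [derivedPair, Ordinal.limitRecOn_add_one]
      exact fun T hT => ih.1 hT.1
    refine ⟨h, ?_⟩
    have e : (derivedPair A Θ (β + 1)).1 = sInf (derivedPair A Θ (β + 1)).2 := by
      simp only [derivedPair, Ordinal.limitRecOn_add_one]
    rw [e]
    exact le_sInf fun T hT => hA T (h hT)
  | limit β hβ ih =>
    have h : (derivedPair A Θ β).2 ⊆ Θ := by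
      rw [derivedPair, Ordinal.limitRecOn_limit _ _ _ _ hβ]
      intro T hT
      have h0 : (0 : Ordinal.{v}) < β := hβ.bot_lt
      exact (ih 0 h0).1 (Set.mem_iInter₂.1 hT 0 h0)
    refine ⟨h, ?_⟩
    have e : (derivedPair A Θ β).1 = sInf (derivedPair A Θ β).2 := by
      rw [derivedPair, Ordinal.limitRecOn_limit _ _ _ _ hβ]
    rw [e]
    exact le_sInf fun T hT => hA T (h hT)

theorem IsPreJaffardFamily.le_of_mem_truncation {A : Subring K} {Θ : Set (Subring K)}
    (hΘ : IsPreJaffardFamily A Θ) {α : Ordinal.{v}} {T : Subring K} (hT : T ∈ truncation A Θ α) :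
    A ≤ T := by
  have hA : ∀ T ∈ Θ, A ≤ T := fun T hT => (hΘ.flat T hT).1
  rcases hT with hT | hT
  · exact hA T hT.1
  · rw [Set.mem_singleton_iff.1 hT]
    exact (derived_subset_and_le A Θ hA α).2

end Families

section Semistar

variable {K : Type u} [Field K]

/-- A `T`-submodule of `K`, seen as an `A`-submodule. -/
def restrict {A T : Subring K} (h : A ≤ T) (J : Submodule T K) : Submodule A K where
  carrier := J
  add_mem' := J.add_mem
  zero_mem' := J.zero_mem
  smul_mem' a _ hx := J.smul_mem (Subring.inclusion h a) hx

/-- The `T`-submodule `IT` of `K`. -/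
def extend {A : Subring K} (T : Subring K) (I : Submodule A K) : Submodule T K :=
  Submodule.span T (I : Set K)

/-- Stable semistar operations on `A`. Here `x • I` is the submodule `xI`, for all `x : K`, zero
included. -/
@[ext]
structure StableSemistar (A : Subring K) where
  toFun : Submodule A K → Submodule A K
  le_toFun' : ∀ I, I ≤ toFun I
  mono' : ∀ I J, I ≤ J → toFun I ≤ toFun J
  idem' : ∀ I, toFun (toFun I) = toFun I
  smul' : ∀ (x : K) (I), x • toFun I = toFun (x • I)
  inf' : ∀ I J, toFun (I ⊓ J) = toFun I ⊓ toFun J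

instance (A : Subring K) : CoeFun (StableSemistar A) fun _ => Submodule A K → Submodule A K :=
  ⟨StableSemistar.toFun⟩

/-- `s ≤ t` if and only if `I^s ⊆ I^t` for all `I`. -/
instance (A : Subring K) : PartialOrder (StableSemistar A) :=
  PartialOrder.lift StableSemistar.toFun fun _ _ h => StableSemistar.ext h

end Semistar

section Length

open CategoryTheory

/-- Length functions on `R`, with values in `[0, ∞]`. -/
@[ext]
structure LengthFunction (R : Type u) [CommRing R] where
  toFun : ModuleCat.{u} R → ℝ≥0∞
  zero' : ∀ M : ModuleCat.{u} R, Subsingleton M → toFun M = 0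
  additive' : ∀ S : ShortComplex (ModuleCat.{u} R), S.ShortExact →
    toFun S.X₂ = toFun S.X₁ + toFun S.X₃
  upperContinuous' : ∀ M : ModuleCat.{u} R,
    toFun M = ⨆ N : {N : Submodule R M // N.FG}, toFun (ModuleCat.of R N.1)

instance (R : Type u) [CommRing R] :
    CoeFun (LengthFunction R) fun _ => ModuleCat.{u} R → ℝ≥0∞ :=
  ⟨LengthFunction.toFun⟩

/-- Length functions are ordered pointwise. -/
instance (R : Type u) [CommRing R] : PartialOrder (LengthFunction R) :=
  PartialOrder.lift LengthFunction.toFun fun _ _ h => LengthFunction.ext h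

/-- A length function is singular if its only values are `0` and `∞`. -/
def LengthFunction.IsSingular {R : Type u} [CommRing R] (ℓ : LengthFunction R) : Prop :=
  ∀ M, ℓ M = 0 ∨ ℓ M = ∞

/-- The set of the singular length functions that do not vanish identically. -/
def SingularLength (R : Type u) [CommRing R] : Type (u + 1) :=
  {ℓ : LengthFunction R // ℓ.IsSingular ∧ ∃ M, ℓ M ≠ 0}

instance (R : Type u) [CommRing R] : PartialOrder (SingularLength R) :=
  inferInstanceAs (PartialOrder {ℓ : LengthFunction R // ℓ.IsSingular ∧ ∃ M, ℓ M ≠ 0})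

variable {K : Type u} [Field K]

/-- A `T`-module, seen as an `A`-module. -/
abbrev restrictModule {A T : Subring K} (h : A ≤ T) (M : ModuleCat.{u} T) : ModuleCat.{u} A :=
  (ModuleCat.restrictScalars (Subring.inclusion h)).obj M

/-- The `T`-module `M ⊗_A T`. -/
abbrev extendModule {A T : Subring K} (h : A ≤ T) (M : ModuleCat.{u} A) : ModuleCat.{u} T :=
  (ModuleCat.extendScalars (Subring.inclusion h)).obj M

end Length

end PreJaffard

end

open PreJaffard

/-! A stable semistar operation `⋆` on `A` is determined by the ideals `I` with `1 ∈ I^⋆`, and a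
singular length function `ℓ` by the ideals `I` with `ℓ(A/I) = 0`. In both cases these ideals form a
Gabriel filter, and all Gabriel filters not containing the zero ideal arise, so both
decompositions follow from one decomposition of such filters over `Θ'`.

Two distinct members of `Θ'` are flat over `D` and generate `K`, so a nonzero ideal contracted from
one of them generates the unit ideal in the other. It remains to see that an ideal `I` lies in a
filter once all the saturations `IT ∩ D` do, which is proved by transfinite induction on `α`.

At a successor step, a Jaffard overring `T` of `T_γ` has a complement `V`, with `T ∩ V = T_γ` and
`T`, `V` generating `K`. A nonprincipal ultrafilter on `Θ_γ` that converges to such a `T` would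
also converge to `K`; by compactness, an ideal that generates the unit ideal in all rings of
`Θ_{γ+1}` does so in all but finitely many rings of `Θ_γ`, and is thus a finite intersection of
saturations. At a limit step, compactness shows that an ideal generating the unit ideal in all rings
of `Θ_α` already does so in all rings of some `Θ_β` with `β < α`. -/

noncomputable section

namespace PreJaffard

section GabrielFilter

theorem colon_singleton_one {R : Type*} [CommRing R] (I : Ideal R) : I.colon {(1 : R)} = I :=
  Ideal.ext fun a => by rw [Submodule.mem_colon_singleton, smul_eq_mul, mul_one]

/-- A Gabriel filter of ideals of `R` that does not contain the zero ideal. The ideal `I.colon {y}`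
consists of the scalars that multiply `y` into `I`. -/
@[ext]
structure GabrielFilter (R : Type*) [CommRing R] where
  sets : Set (Ideal R)
  top_mem' : ⊤ ∈ sets
  mono' : ∀ I J, I ∈ sets → I ≤ J → J ∈ sets
  gabriel' : ∀ J ∈ sets, ∀ I : Ideal R, (∀ y ∈ J, I.colon {y} ∈ sets) → I ∈ sets
  bot_notMem' : ⊥ ∉ sets

namespace GabrielFilter

variable {R : Type*} [CommRing R]

instance : Membership (Ideal R) (GabrielFilter R) := ⟨fun F I => I ∈ F.sets⟩

instance : PartialOrder (GabrielFilter R) :=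
  PartialOrder.lift sets fun _ _ h => GabrielFilter.ext h

theorem top_mem (F : GabrielFilter R) : ⊤ ∈ F := F.top_mem'

theorem mono (F : GabrielFilter R) {I J : Ideal R} (hI : I ∈ F) (h : I ≤ J) : J ∈ F :=
  F.mono' I J hI h

theorem mem_of_forall_colon_mem (F : GabrielFilter R) {I J : Ideal R} (hJ : J ∈ F)
    (h : ∀ y ∈ J, I.colon {y} ∈ F) : I ∈ F :=
  F.gabriel' J hJ I h

theorem bot_notMem (F : GabrielFilter R) : ⊥ ∉ F := F.bot_notMem'

theorem inf_mem (F : GabrielFilter R) {I J : Ideal R} (hI : I ∈ F) (hJ : J ∈ F) : I ⊓ J ∈ F :=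
  F.mem_of_forall_colon_mem hI fun y hy => F.mono hJ fun a ha =>
    Submodule.mem_colon_singleton.2 ⟨I.mul_mem_left a hy, J.mul_mem_right y ha⟩

theorem finset_inf_mem (F : GabrielFilter R) {ι : Type*} {s : Finset ι} {I : ι → Ideal R}
    (h : ∀ i ∈ s, I i ∈ F) : s.inf I ∈ F :=
  Finset.inf_induction F.top_mem (fun _ hI _ hJ => F.inf_mem hI hJ) h

variable {M : Type*} [AddCommGroup M] [Module R M]

/-- The closure of a submodule `N` of `M` with respect to `F`: the preimage in `M` of the
`F`-torsion submodule of `M ⧸ N`. -/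
def closure (F : GabrielFilter R) (N : Submodule R M) : Submodule R M where
  carrier := {m | N.colon {m} ∈ F}
  zero_mem' := F.mono F.top_mem (Submodule.colon_singleton_zero (N := N)).ge
  add_mem' {x y} hx hy := F.mono (F.inf_mem hx hy) fun a ha => by
    rw [Submodule.mem_colon_singleton, smul_add]
    exact add_mem (Submodule.mem_colon_singleton.1 ha.1) (Submodule.mem_colon_singleton.1 ha.2)
  smul_mem' r x hx := F.mono hx fun a ha => by
    rw [Submodule.mem_colon_singleton, smul_comm]
    exact N.smul_mem r (Submodule.mem_colon_singleton.1 ha)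

variable (F : GabrielFilter R)

theorem mem_closure {N : Submodule R M} {m : M} : m ∈ F.closure N ↔ N.colon {m} ∈ F := Iff.rfl

theorem le_closure (N : Submodule R M) : N ≤ F.closure N := fun _ hm =>
  F.mono F.top_mem ((Submodule.colon_eq_top_iff_subset _).2 (Set.singleton_subset_iff.2 hm)).ge

theorem closure_mono {N P : Submodule R M} (h : N ≤ P) : F.closure N ≤ F.closure P :=
  fun _ hm => F.mono hm (Submodule.colon_mono h subset_rfl)

theorem closure_inf (N P : Submodule R M) : F.closure (N ⊓ P) = F.closure N ⊓ F.closure P :=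
  le_antisymm (le_inf (F.closure_mono inf_le_left) (F.closure_mono inf_le_right)) fun _ hm =>
    F.mem_closure.2 (Submodule.inf_colon (N₁ := N) (N₂ := P) ▸ F.inf_mem hm.1 hm.2)

theorem mem_closure_of_forall_smul_mem {N : Submodule R M} {J : Ideal R} (hJ : J ∈ F) {m : M}
    (h : ∀ a ∈ J, a • m ∈ F.closure N) : m ∈ F.closure N :=
  F.mem_of_forall_colon_mem hJ fun a ha => F.mono (h a ha) fun b hb => by
    simpa only [Submodule.mem_colon_singleton, smul_eq_mul, mul_smul] using hb

theorem closure_closure (N : Submodule R M) : F.closure (F.closure N) = F.closure N :=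
  le_antisymm (fun _ hm => F.mem_closure_of_forall_smul_mem hm fun _ ha =>
    Submodule.mem_colon_singleton.1 ha) (F.le_closure _)

variable (R) in
/-- The Gabriel filter whose only member is the unit ideal. -/
def trivial [Nontrivial R] : GabrielFilter R where
  sets := {⊤}
  top_mem' := rfl
  mono' _ _ hI h := top_unique (hI.symm.le.trans h)
  gabriel' J hJ I h := by
    have hone : (1 : R) ∈ J := (hJ : J = ⊤) ▸ Submodule.mem_top
    exact (Ideal.eq_top_iff_one I).2 <| Set.singleton_subset_iff.1 <|
      (Submodule.colon_eq_top_iff_subset _).1 (h 1 hone)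
  bot_notMem' := bot_ne_top

variable {S : Type*} [CommRing S]

/-- The Gabriel filter on `S` of the ideals whose contraction to `R` belongs to `F`. -/
def map (φ : R →+* S) (hφ : Function.Injective φ) : GabrielFilter S where
  sets := {J | J.comap φ ∈ F}
  top_mem' := F.top_mem
  mono' _ _ hI h := F.mono hI (Ideal.comap_mono h)
  gabriel' J hJ I h := F.mem_of_forall_colon_mem hJ fun y hy => F.mono (h (φ y) hy) fun a ha => by
    simpa only [Ideal.mem_comap, Submodule.mem_colon_singleton, smul_eq_mul, map_mul] using ha
  bot_notMem' h := F.bot_notMem <| F.mono h (Ideal.comap_bot_of_injective φ hφ).le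

/-- The Gabriel filter on `R` of the ideals whose extension to `S` belongs to `G`. -/
def comap (φ : R →+* S) (G : GabrielFilter S) : GabrielFilter R where
  sets := {I | I.map φ ∈ G}
  top_mem' := G.mono G.top_mem (Ideal.map_top φ).ge
  mono' _ _ hI h := G.mono hI (Ideal.map_mono h)
  gabriel' J hJ I h := by
    have hle : J.map φ ≤ G.closure (I.map φ) :=
      Ideal.map_le_iff_le_comap.2 fun y hy => G.mono (h y hy) <|
        Ideal.map_le_iff_le_comap.2 fun a ha => by
          simpa only [Ideal.mem_comap, Submodule.mem_colon_singleton, smul_eq_mul, map_mul]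
            using Ideal.mem_map_of_mem φ (Submodule.mem_colon_singleton.1 ha)
    exact G.mem_of_forall_colon_mem hJ hle
  bot_notMem' h := G.bot_notMem <| G.mono h (Ideal.map_bot (f := φ)).le

/-- The intersection of a nonempty family of Gabriel filters. -/
protected def iInf {ι : Type*} [Nonempty ι] (F : ι → GabrielFilter R) : GabrielFilter R where
  sets := {I | ∀ i, I ∈ F i}
  top_mem' i := (F i).top_mem
  mono' _ _ hI h i := (F i).mono (hI i) h
  gabriel' _ hJ _ h i := (F i).mem_of_forall_colon_mem (hJ i) fun y hy => h y hy i
  bot_notMem' h := (F (Classical.arbitrary ι)).bot_notMem (h _)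

end GabrielFilter

end GabrielFilter

section GabrielDecomposition

/-- The ideal `IS ∩ R` of `R`, for a ring homomorphism `φ : R → S`. -/
def saturation {R S : Type*} [CommRing R] [CommRing S] (φ : R →+* S) (I : Ideal R) : Ideal R :=
  (I.map φ).comap φ

theorem le_saturation {R S : Type*} [CommRing R] [CommRing S] (φ : R →+* S) (I : Ideal R) :
    I ≤ saturation φ I :=
  Ideal.le_comap_map

theorem saturation_mono {R S : Type*} [CommRing R] [CommRing S] (φ : R →+* S) {I J : Ideal R}
    (h : I ≤ J) : saturation φ I ≤ saturation φ J :=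
  Ideal.comap_mono (Ideal.map_mono h)

/-- A family of injective flat maps `R → S i` that splits the poset of the Gabriel
filters of `R` as a product: the `S i` are orthogonal to each other, and membership in a Gabriel
filter is detected on the saturations `I S i ∩ R`. -/
structure IsGabrielDecomposition {R : Type*} [CommRing R] {ι : Type*} {S : ι → Type*}
    [∀ i, CommRing (S i)] (φ : ∀ i, R →+* S i) : Prop where
  injective : ∀ i, Function.Injective (φ i)
  flat : ∀ i, (φ i).Flat
  map_comap : ∀ i (J : Ideal (S i)), (J.comap (φ i)).map (φ i) = J
  map_comap_eq_top : ∀ i j, i ≠ j → ∀ J : Ideal (S i), J ≠ ⊥ → (J.comap (φ i)).map (φ j) = ⊤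
  mem_of_saturation_mem : ∀ (F : GabrielFilter R) (I : Ideal R),
    (∀ i, saturation (φ i) I ∈ F) → I ∈ F

variable {R : Type*} [CommRing R] {ι : Type*} [Nonempty ι] {S : ι → Type*} [∀ i, CommRing (S i)]
  {φ : ∀ i, R →+* S i}

/-- The isomorphism `F ↦ (F.map (φ i))ᵢ`, with inverse `G ↦ ⋂ i, (G i).comap (φ i)`. -/
def IsGabrielDecomposition.gabrielIso (h : IsGabrielDecomposition φ) :
    GabrielFilter R ≃o ∀ i, GabrielFilter (S i) where
  toFun F i := F.map (φ i) (h.injective i)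
  invFun G := GabrielFilter.iInf fun i => (G i).comap (φ i)
  left_inv F := GabrielFilter.ext <| Set.ext fun I =>
    ⟨h.mem_of_saturation_mem F I, fun hI i => F.mono hI (le_saturation (φ i) I)⟩
  right_inv G := by
    refine funext fun i => GabrielFilter.ext <| Set.ext fun J => ⟨fun hJ => ?_, fun hJ j => ?_⟩
    · exact (G i).mono (hJ i) (h.map_comap i J).le
    · obtain rfl | hij := eq_or_ne i j
      · exact (G i).mono hJ (h.map_comap i J).ge
      · have hJ0 : J ≠ ⊥ := fun h0 => (G i).bot_notMem (h0 ▸ hJ)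
        exact (G j).mono (G j).top_mem (h.map_comap_eq_top i j hij J hJ0).ge
  map_rel_iff' {F G} :=
    ⟨fun hle I hI => h.mem_of_saturation_mem G I fun i => hle i (F.mono hI (le_saturation _ I)),
      fun hle _ _ hJ => hle hJ⟩

end GabrielDecomposition

/-- The order isomorphism of products induced by a family of order isomorphisms. -/
def orderIsoPiCongrRight {ι : Type*} {α β : ι → Type*} [∀ i, LE (α i)] [∀ i, LE (β i)]
    (e : ∀ i, α i ≃o β i) : (∀ i, α i) ≃o ∀ i, β i where
  toEquiv := Equiv.piCongrRight fun i => (e i).toEquiv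
  map_rel_iff' := forall_congr' fun i => (e i).le_iff_le

section Spanning

variable {K : Type u} [Field K] {A S T : Subring K}

/-- The ideal `I` of `A` generates the unit ideal of the overring `T`. The definition makes sense
without assuming that `A ≤ T`. -/
def SpansOne (I : Ideal A) (T : Subring K) : Prop :=
  (1 : K) ∈ Submodule.span T (Subtype.val '' (I : Set A))

theorem mem_map_inclusion (h : A ≤ T) {I : Ideal A} {x : T} :
    x ∈ I.map (Subring.inclusion h) ↔ (x : K) ∈ Submodule.span T (Subtype.val '' (I : Set A)) := by
  have hspan : Submodule.span T (Subtype.val '' (I : Set A)) =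
      Submodule.map (Algebra.linearMap T K) (I.map (Subring.inclusion h)) := by
    rw [Ideal.map, Ideal.span, Submodule.map_span, ← Set.image_comp]
    rfl
  rw [hspan]
  exact (Function.Injective.mem_set_image Subtype.val_injective).symm

theorem mem_saturation_inclusion (h : A ≤ T) {I : Ideal A} {x : A} :
    x ∈ saturation (Subring.inclusion h) I ↔
      (x : K) ∈ Submodule.span T (Subtype.val '' (I : Set A)) :=
  mem_map_inclusion h

theorem spansOne_iff_map_eq_top (h : A ≤ T) {I : Ideal A} :
    SpansOne I T ↔ I.map (Subring.inclusion h) = ⊤ := by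
  rw [Ideal.eq_top_iff_one, mem_map_inclusion, SpansOne, OneMemClass.coe_one]

theorem spansOne_self {I : Ideal A} : SpansOne I A ↔ I = ⊤ := by
  rw [spansOne_iff_map_eq_top le_rfl]
  exact iff_of_eq (congrArg (· = ⊤) (Ideal.map_id I))

theorem map_inclusion_ne_bot (h : A ≤ T) {I : Ideal A} (hI : I ≠ ⊥) :
    I.map (Subring.inclusion h) ≠ ⊥ :=
  (Ideal.map_eq_bot_iff_of_injective (Subring.inclusion_injective h)).not.2 hI

theorem spansOne_map (hS : A ≤ S) (hT : S ≤ T) {I : Ideal A} :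
    SpansOne (I.map (Subring.inclusion hS)) T ↔ SpansOne I T := by
  rw [spansOne_iff_map_eq_top hT, spansOne_iff_map_eq_top (hS.trans hT), Ideal.map_map]
  rfl

theorem SpansOne.mono {I J : Ideal A} (hI : SpansOne I T) (h : I ≤ J) : SpansOne J T :=
  Submodule.span_mono (Set.image_mono h) hI

theorem SpansOne.of_le {I : Ideal A} (hI : SpansOne I S) (h : S ≤ T) : SpansOne I T := by
  have hle : Submodule.span S (Subtype.val '' (I : Set A)) ≤
      restrict h (Submodule.span T (Subtype.val '' (I : Set A))) :=
    Submodule.span_le.2 Submodule.subset_span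
  exact hle hI

theorem SpansOne.mem_of_forall_mul_mem {I : Ideal A} (hI : SpansOne I T) {M : Submodule T K} {x : K}
    (h : ∀ a ∈ I, (a : K) * x ∈ M) : x ∈ M := by
  have hle : Submodule.span T (Subtype.val '' (I : Set A)) ≤
      M.comap (LinearMap.mulRight T x) :=
    Submodule.span_le.2 (Set.forall_mem_image.2 h)
  simpa only [Submodule.mem_comap, LinearMap.mulRight_apply, one_mul] using hle hI

theorem SpansOne.mem_subring {I : Ideal A} (hI : SpansOne I T) {x : K}
    (h : ∀ a ∈ I, (a : K) * x ∈ T) : x ∈ T := by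
  have hx : x ∈ (1 : Submodule T K) := hI.mem_of_forall_mul_mem fun a ha =>
    Submodule.mem_one.2 ⟨⟨_, h a ha⟩, rfl⟩
  obtain ⟨t, rfl⟩ := Submodule.mem_one.1 hx
  exact t.2

theorem SpansOne.ne_bot {I : Ideal A} (hI : SpansOne I T) : I ≠ ⊥ := by
  rintro rfl
  have h : (1 : K) ∈ (⊥ : Submodule T K) :=
    hI.mem_of_forall_mul_mem fun a ha => by simp [(Submodule.mem_bot A).1 ha]
  exact one_ne_zero ((Submodule.mem_bot T).1 h)

theorem spansOne_of_inv_mem {I : Ideal A} {f : A} (hf : f ∈ I) (hf0 : f ≠ 0)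
    (h : (f : K)⁻¹ ∈ T) : SpansOne I T := by
  have hmem := Submodule.smul_mem _ (⟨_, h⟩ : T)
    (Submodule.subset_span (R := T) (Set.mem_image_of_mem Subtype.val hf))
  rwa [Subring.smul_def, smul_eq_mul, inv_mul_cancel₀ (Subtype.coe_ne_coe.2 hf0)] at hmem

theorem spansOne_top {I : Ideal A} (hI : I ≠ ⊥) : SpansOne I (⊤ : Subring K) := by
  obtain ⟨f, hf, hf0⟩ := Submodule.exists_mem_ne_zero_of_ne_bot hI
  exact spansOne_of_inv_mem hf hf0 (Subring.mem_top _)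

/-- The Gabriel filter of the ideals of `A` that generate the unit ideal of `T`. -/
def spanningFilter (h : A ≤ T) : GabrielFilter A :=
  (GabrielFilter.trivial T).comap (Subring.inclusion h)

theorem mem_spanningFilter (h : A ≤ T) {I : Ideal A} : I ∈ spanningFilter h ↔ SpansOne I T :=
  (spansOne_iff_map_eq_top h).symm

/-- The ideal of the elements `a` of `A` such that `a * x` belongs to `V`. -/
def conductor {V : Subring K} (h : A ≤ V) (x : K) : Ideal A :=
  (restrict h 1).colon {x}

theorem mem_conductor {V : Subring K} {h : A ≤ V} {x : K} {a : A} :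
    a ∈ conductor h x ↔ (a : K) * x ∈ V := by
  refine Submodule.mem_colon_singleton.trans ⟨?_, fun ha => Submodule.mem_one.2 ⟨⟨_, ha⟩, rfl⟩⟩
  intro ha
  obtain ⟨v, hv⟩ := Submodule.mem_one.1 ha
  exact (show (v : K) = a * x from hv) ▸ v.2

section FractionRing

variable [IsFractionRing A K]

theorem exists_mul_mem (x : K) : ∃ b : A, b ≠ 0 ∧ (b : K) * x ∈ A := by
  obtain ⟨⟨a, b⟩, hb⟩ := IsLocalization.surj (nonZeroDivisors A) x
  refine ⟨b, nonZeroDivisors.coe_ne_zero b, ?_⟩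
  rw [mul_comm]
  exact (show x * (b : A) = a from hb) ▸ a.2

theorem isFractionRing_of_le (h : A ≤ T) : IsFractionRing T K :=
  IsFractionRing.of_field T K fun x => by
    obtain ⟨b, hb0, hb⟩ := exists_mul_mem (A := A) x
    refine ⟨⟨_, h hb⟩, ⟨b, h b.2⟩, ?_⟩
    exact eq_div_of_mul_eq (Subtype.coe_ne_coe.2 hb0) (mul_comm x b)

theorem conductor_ne_bot {V : Subring K} (h : A ≤ V) (x : K) : conductor h x ≠ ⊥ := by
  obtain ⟨b, hb0, hb⟩ := exists_mul_mem (A := A) x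
  exact (Submodule.ne_bot_iff _).2 ⟨b, mem_conductor.2 (h hb), hb0⟩

theorem comap_inclusion_ne_bot (h : A ≤ T) {J : Ideal T} (hJ : J ≠ ⊥) :
    J.comap (Subring.inclusion h) ≠ ⊥ := by
  obtain ⟨x, hx, hx0⟩ := Submodule.exists_mem_ne_zero_of_ne_bot hJ
  obtain ⟨b, hb0, hb⟩ := exists_mul_mem (A := A) (x : K)
  refine (Submodule.ne_bot_iff _).2 ⟨⟨_, hb⟩, J.mul_mem_left ⟨b, h b.2⟩ hx, fun h0 => ?_⟩
  exact mul_ne_zero (Subtype.coe_ne_coe.2 hb0) (Subtype.coe_ne_coe.2 hx0) (congrArg Subtype.val h0)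

end FractionRing

theorem spansOne_comap_of_spansOne_conductor (hT : A ≤ T) (h : ∀ x, SpansOne (conductor hT x) S)
    {J : Ideal T} (hJ : J ≠ ⊥) : SpansOne (J.comap (Subring.inclusion hT)) S := by
  obtain ⟨x, hx, hx0⟩ := Submodule.exists_mem_ne_zero_of_ne_bot hJ
  refine (h (x : K)⁻¹).mono fun a ha => ?_
  have ha' : Subring.inclusion hT a = ⟨a * (x : K)⁻¹, mem_conductor.1 ha⟩ * x :=
    Subtype.ext (inv_mul_cancel_right₀ (Subtype.coe_ne_coe.2 hx0) (a : K)).symm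
  rw [Ideal.mem_comap, ha']
  exact J.mul_mem_left _ hx

end Spanning

section FlatOverring

variable {K : Type u} [Field K] {A S T : Subring K}

theorem exists_sum_of_flat {R M : Type*} [CommRing R] [AddCommGroup M] [Module R M]
    [Module.Flat R M] {a b : R} {u x : M} (hab : a • u = b • x) :
    ∃ (k : ℕ) (c d : Fin k → R) (y : Fin k → M),
      u = ∑ j, c j • y j ∧ ∀ j, a * c j = b * d j := by
  have hrel : ∑ i, (![a, -b] : Fin 2 → R) i • (![u, x] : Fin 2 → M) i = 0 := by
    simp [Fin.sum_univ_two, hab]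
  obtain ⟨k, c, y, hy, hc⟩ := Module.Flat.isTrivialRelation_of_sum_smul_eq_zero hrel
  refine ⟨k, c 0, c 1, y, hy 0, fun j => ?_⟩
  simpa [Fin.sum_univ_two, add_neg_eq_zero] using hc j

theorem IsFlatOverring.spansOne_conductor [IsFractionRing A K] (h : IsFlatOverring A T) {x : K}
    (hx : x ∈ T) : SpansOne (conductor le_rfl x : Ideal A) T := by
  obtain ⟨hle, hf⟩ := h
  obtain ⟨b, hb0, hbx⟩ := exists_mul_mem (A := A) x
  algebraize [Subring.inclusion hle]
  obtain ⟨k, c, d, y, hsum, hcd⟩ := exists_sum_of_flat (R := A) (M := T)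
    (a := ⟨b * x, hbx⟩) (b := b) (u := 1) (x := ⟨x, hx⟩) (Subtype.ext (mul_one _))
  have hone : (1 : K) = ∑ j, y j • (c j : K) := by
    have hval := congrArg (Subtype.val : T → K) hsum
    rw [AddSubmonoidClass.coe_finsetSum] at hval
    exact hval.trans (Finset.sum_congr rfl fun j _ => mul_comm (c j : K) (y j : K))
  rw [SpansOne, hone]
  refine sum_mem fun j _ => Submodule.smul_mem _ _ (Submodule.subset_span ⟨c j, ?_, rfl⟩)
  have hcx : (c j : K) * x = d j := by
    have hval : b * x * c j = b * d j := congrArg (Subtype.val : A → K) (hcd j)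
    exact mul_left_cancel₀ (Subtype.coe_ne_coe.2 hb0) (by linear_combination hval)
  exact mem_conductor.2 (hcx ▸ (d j).2)

theorem isFlatOverring_of_spansOne_conductor (hle : A ≤ T)
    (h : ∀ x ∈ T, SpansOne (conductor le_rfl x : Ideal A) T) : IsFlatOverring A T := by
  refine ⟨hle, ?_⟩
  algebraize_only [Subring.inclusion hle]
  change Module.Flat A T
  refine Module.Flat.of_forall_isTrivialRelation fun {l f x} hfx => ?_
  have hspan : SpansOne (Finset.univ.inf fun i => (conductor le_rfl (x i : K) : Ideal A)) T :=
    (mem_spanningFilter hle).1 <| GabrielFilter.finset_inf_mem _ fun i _ =>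
      (mem_spanningFilter hle).2 (h _ (x i).2)
  obtain ⟨k, y, g, hg⟩ := Submodule.mem_span_set'.1 hspan
  choose c hc hcg using fun j => (g j).2
  have hcx (i j) : (c j : K) * x i ∈ A :=
    mem_conductor.1 (Submodule.mem_finsetInf.1 (hc j) i (Finset.mem_univ i))
  have hone : ∑ j, (y j : K) * c j = 1 := by
    simpa only [hcg, Subring.smul_def, smul_eq_mul] using hg
  have hrel : ∑ i, (f i : K) * x i = 0 := by
    have hval := congrArg (Subtype.val : T → K) hfx
    rwa [AddSubmonoidClass.coe_finsetSum] at hval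
  refine ⟨k, fun i j => ⟨c j * x i, hcx i j⟩, y, fun i => Subtype.ext ?_, fun j => Subtype.ext ?_⟩
  · rw [AddSubmonoidClass.coe_finsetSum]
    calc (x i : K) = (∑ j, (y j : K) * c j) * x i := by rw [hone, one_mul]
      _ = ∑ j, (c j * x i : K) * y j := by
        rw [Finset.sum_mul]
        exact Finset.sum_congr rfl fun j _ => by ring
  · rw [AddSubmonoidClass.coe_finsetSum]
    calc ∑ i, (f i : K) * (c j * x i) = c j * ∑ i, (f i : K) * x i := by
          rw [Finset.mul_sum]
          exact Finset.sum_congr rfl fun i _ => by ring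
      _ = 0 := by rw [hrel, mul_zero]

theorem IsFlatOverring.refl (A : Subring K) : IsFlatOverring A A :=
  ⟨le_rfl, RingHom.Flat.id A⟩

theorem IsFlatOverring.trans (hS : IsFlatOverring A S) (hT : IsFlatOverring S T) :
    IsFlatOverring A T :=
  ⟨hS.1.trans hT.1, hS.2.comp hT.2⟩

variable [IsFractionRing A K]

theorem IsFlatOverring.of_le (h : IsFlatOverring A T) (hAS : A ≤ S) (hST : S ≤ T) :
    IsFlatOverring S T :=
  isFlatOverring_of_spansOne_conductor hST fun x hx =>
    ((spansOne_map hAS hST).2 (h.spansOne_conductor hx)).mono <|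
      Ideal.map_le_iff_le_comap.2 fun a ha =>
        have haS : (a : K) * x ∈ S := hAS (mem_conductor.1 ha)
        Ideal.mem_comap.2 (mem_conductor.2 haS)

theorem IsFlatOverring.spansOne_colon (h : IsFlatOverring A T) {X : Submodule A K} {y : K}
    (hy : y ∈ extend T X) : SpansOne (X.colon {y}) T := by
  let F := spanningFilter h.1
  suffices hF : y ∈ F.closure X from (mem_spanningFilter h.1).1 hF
  induction hy using Submodule.span_induction with
  | mem x hx => exact F.le_closure X hx
  | zero => exact zero_mem _
  | add x y _ _ hx hy => exact add_mem hx hy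
  | smul t x _ hx =>
    refine F.mem_closure_of_forall_smul_mem
      ((mem_spanningFilter h.1).2 (h.spansOne_conductor t.2)) fun a ha => ?_
    have hsmul : a • t • x = (⟨_, mem_conductor.1 ha⟩ : A) • x := (mul_assoc (a : K) t x).symm
    exact hsmul ▸ Submodule.smul_mem _ _ hx

theorem IsFlatOverring.spansOne_colon_of_mem_saturation (h : IsFlatOverring A T) {I : Ideal A}
    {a : A} (ha : a ∈ saturation (Subring.inclusion h.1) I) : SpansOne (I.colon {a}) T := by
  refine (h.spansOne_colon (X := Submodule.map (Algebra.linearMap A K) I)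
    ((mem_saturation_inclusion h.1).1 ha)).mono fun b hb => ?_
  obtain ⟨c, hc, hcb⟩ := Submodule.mem_colon_singleton.1 hb
  rw [Submodule.mem_colon_singleton]
  exact (Subtype.ext hcb : c = b • a) ▸ hc

theorem mem_span_of_sup_eq_top (h : S ⊔ T = ⊤) (x : K) : x ∈ Submodule.span S (T : Set K) := by
  have htop : (Algebra.adjoin S (T : Set K)).toSubring = ⊤ := by
    refine eq_top_iff.2 (h ▸ sup_le (fun s hs => ?_) Algebra.subset_adjoin)
    exact (Algebra.adjoin S (T : Set K)).algebraMap_mem ⟨s, hs⟩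
  have hx : x ∈ Subalgebra.toSubmodule (Algebra.adjoin S (T : Set K)) :=
    htop.ge (Subring.mem_top x)
  rw [Algebra.adjoin_eq_span] at hx
  have hT : (Submonoid.closure (T : Set K) : Set K) = T :=
    congrArg SetLike.coe (Submonoid.closure_eq T.toSubmonoid)
  rwa [hT] at hx

theorem IsFlatOverring.spansOne_conductor_of_sup_eq_top (hS : IsFlatOverring A S) (hT : A ≤ T)
    (h : S ⊔ T = ⊤) (x : K) : SpansOne (conductor hT x) S := by
  refine hS.spansOne_colon (Submodule.span_mono (fun t ht => ?_) (mem_span_of_sup_eq_top h x))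
  exact Submodule.mem_one.2 ⟨⟨t, ht⟩, rfl⟩

theorem IsFlatOverring.map_comap (h : IsFlatOverring A T) (J : Ideal T) :
    (J.comap (Subring.inclusion h.1)).map (Subring.inclusion h.1) = J := by
  refine le_antisymm Ideal.map_comap_le fun x hx => (mem_map_inclusion h.1).2 ?_
  refine (h.spansOne_conductor x.2).mem_of_forall_mul_mem fun a ha =>
    Submodule.subset_span
      ⟨⟨_, mem_conductor.1 ha⟩, J.mul_mem_left (Subring.inclusion h.1 a) hx, rfl⟩

theorem IsFlatOverring.spansOne_comap_iff (h : IsFlatOverring A S) (hST : S ≤ T) {J : Ideal S} :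
    SpansOne (J.comap (Subring.inclusion h.1)) T ↔ SpansOne J T := by
  rw [← spansOne_map h.1 hST, h.map_comap]

end FlatOverring

section FlatFamily

variable {K : Type u} [Field K] {A S T : Subring K} {Θ : Set (Subring K)}

/-- A family of pairwise orthogonal flat overrings of `A` that is complete with respect to the
nonzero ideals of `A`. The zero ideal is left out in order to allow the empty family, with `A = K`,
in which the derived sequence of a pre-Jaffard family may end. -/
structure IsFlatFamily (A : Subring K) (Θ : Set (Subring K)) : Prop where
  flat : ∀ T ∈ Θ, IsFlatOverring A T
  sup_eq_top : ∀ S ∈ Θ, ∀ T ∈ Θ, S ≠ T → S ⊔ T = ⊤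
  complete : ∀ I : Ideal A, I ≠ ⊥ → (∀ T ∈ Θ, SpansOne I T) → I = ⊤

theorem IsFlatFamily.base_le_sInf (h : IsFlatFamily A Θ) {Ψ : Set (Subring K)} (hΨ : Ψ ⊆ Θ) :
    A ≤ sInf Ψ :=
  le_sInf fun T hT => (h.flat T (hΨ hT)).1

theorem IsFlatFamily.spansOne_base (h : IsFlatFamily A Θ) (hS : S ≤ A) {I : Ideal S} (hI : I ≠ ⊥)
    (hIΘ : ∀ T ∈ Θ, SpansOne I T) : SpansOne I A :=
  (spansOne_iff_map_eq_top hS).2 <| h.complete _ (map_inclusion_ne_bot hS hI) fun T hT =>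
    (spansOne_map hS (h.flat T hT).1).2 (hIΘ T hT)

theorem comap_mem_contractions {B : Subring K} (hA : A ≤ B) (hT : T ≤ B) (hAT : A ≤ T)
    (Q : PrimeSpectrum B) :
    PrimeSpectrum.comap (Subring.inclusion hA) Q ∈ contractions A T := by
  refine ⟨PrimeSpectrum.comap (Subring.inclusion hT) Q, Set.ext fun x => ⟨?_, ?_⟩⟩
  · rintro ⟨a, ha, rfl⟩
    exact ⟨⟨⟨a, hAT a.2⟩, ha, rfl⟩, a.2⟩
  · rintro ⟨⟨t, ht, rfl⟩, hx⟩
    exact ⟨⟨t, hx⟩, ht, rfl⟩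

theorem IsComplete.eq_top_of_spansOne (h : IsComplete A Θ) {I : Ideal A}
    (hI : ∀ T ∈ Θ, SpansOne I T) : I = ⊤ := by
  have hone : (1 : K) ∈ Subtype.val '' (I : Set A) := h I ▸ Set.mem_iInter₂.2 hI
  obtain ⟨a, ha, ha1⟩ := hone
  exact (Ideal.eq_top_iff_one I).2 ((Subtype.ext ha1 : a = 1) ▸ ha)

variable [IsFractionRing A K]

theorem IsFlatFamily.mem_of_forall_mem_saturation (h : IsFlatFamily A Θ) {I : Ideal A} (hI : I ≠ ⊥)
    {a : A} (ha : ∀ T (hT : T ∈ Θ), a ∈ saturation (Subring.inclusion (h.flat T hT).1) I) :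
    a ∈ I := by
  have htop : I.colon {a} = ⊤ := h.complete _ (ne_bot_of_le_ne_bot hI Ideal.le_colon) fun T hT =>
    (h.flat T hT).spansOne_colon_of_mem_saturation (ha T hT)
  exact (Submodule.colon_eq_top_iff_subset _).1 htop rfl

theorem IsFlatFamily.mem_of_forall_mem (h : IsFlatFamily A Θ) {x : K} (hx : ∀ T ∈ Θ, x ∈ T) :
    x ∈ A := by
  have htop : (conductor le_rfl x : Ideal A) = ⊤ :=
    h.complete _ (conductor_ne_bot le_rfl x) fun T hT => (h.flat T hT).spansOne_conductor (hx T hT)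
  simpa using mem_conductor.1 (htop.ge (Submodule.mem_top (x := 1)))

theorem IsFlatFamily.conductor_sup_conductor_eq_top (h : IsFlatFamily A Θ) (hS : S ∈ Θ)
    (hT : T ∈ Θ) (hST : S ≠ T) (x : K) :
    conductor (h.flat S hS).1 x ⊔ conductor (h.flat T hT).1 x = ⊤ := by
  refine h.complete _ (ne_bot_of_le_ne_bot (conductor_ne_bot _ x) le_sup_left) fun V hV => ?_
  have spansOne_of_ne {W : Subring K} (hW : W ∈ Θ) (hVW : V ≠ W) :
      SpansOne (conductor (h.flat W hW).1 x) V :=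
    (h.flat V hV).spansOne_conductor_of_sup_eq_top _ (h.sup_eq_top V hV W hW hVW) x
  obtain rfl | hVS := eq_or_ne V S
  · exact (spansOne_of_ne hT hST).mono le_sup_right
  · exact (spansOne_of_ne hS hVS).mono le_sup_left

theorem IsIndependent.sup_eq_top (h : IsIndependent A Θ) (hle : ∀ T ∈ Θ, A ≤ T) (hS : S ∈ Θ)
    (hT : T ∈ Θ) (hST : S ≠ T) : S ⊔ T = ⊤ := by
  have hA : A ≤ S ⊔ T := (hle S hS).trans le_sup_left
  have := isFractionRing_of_le hA
  by_contra hne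
  have hfield : ¬ IsField (S ⊔ T : Subring K) := fun hf =>
    hne <| eq_top_iff.2 fun x _ => by
      obtain ⟨y, rfl⟩ := IsFractionRing.surjective_iff_isField.2 hf x
      exact y.2
  obtain ⟨Q, hQ⟩ := Ideal.exists_maximal (S ⊔ T : Subring K)
  have hP := (h S hS T hT hST (PrimeSpectrum.comap (Subring.inclusion hA) ⟨Q, hQ.isPrime⟩)).1
    ⟨comap_mem_contractions hA le_sup_left (hle S hS) _,
      comap_mem_contractions hA le_sup_right (hle T hT) _⟩
  exact comap_inclusion_ne_bot hA (Ring.ne_bot_of_isMaximal_of_not_isField hQ hfield) hP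

theorem IsIndependent.isFlatFamily (h : IsIndependent A Θ) (hflat : ∀ T ∈ Θ, IsFlatOverring A T)
    (hc : IsComplete A Θ) : IsFlatFamily A Θ where
  flat := hflat
  sup_eq_top _ hS _ hT := h.sup_eq_top (fun T hT => (hflat T hT).1) hS hT
  complete _ _ := hc.eq_top_of_spansOne

end FlatFamily

section Complement

variable {K : Type u} [Field K] {A S T V : Subring K} {Θ : Set (Subring K)}

/-- `V` is a complement of `T` over `A`: the `A`-module `K / A` is the direct sum
of `T / A` and `V / A`. -/
structure IsComplement (A T V : Subring K) : Prop where
  inf_eq : T ⊓ V = A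
  exists_add_eq : ∀ x, ∃ t ∈ T, ∃ v ∈ V, t + v = x

theorem IsComplement.sup_eq_top (h : IsComplement A T V) : T ⊔ V = ⊤ := by
  refine eq_top_iff.2 fun x _ => ?_
  obtain ⟨t, ht, v, hv, rfl⟩ := h.exists_add_eq x
  exact add_mem (le_sup_left (a := T) ht) (le_sup_right (a := T) hv)

variable [IsFractionRing A K]

theorem IsFlatFamily.exists_mem_add_mem_sInf (h : IsFlatFamily A Θ) (hfin : IsLocallyFinite Θ)
    (hT : T ∈ Θ) (x : K) : ∃ t ∈ T, ∃ v ∈ sInf (Θ \ {T}), t + v = x := by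
  obtain rfl | hx0 := eq_or_ne x 0
  · exact ⟨0, zero_mem _, 0, zero_mem _, add_zero 0⟩
  let J (V : Θ) : Ideal A := conductor (h.flat V V.2).1 x
  have hE : {V : Θ | V.1 ≠ T ∧ x ∉ V.1}.Finite :=
    ((hfin x hx0).preimage Subtype.val_injective.injOn).subset fun V hV =>
      ⟨V.2, fun hxV => hV.2 hxV.1⟩
  have hsup : J ⟨T, hT⟩ ⊔ ∏ V ∈ hE.toFinset, J V = ⊤ := Ideal.sup_prod_eq_top fun V hV =>
    h.conductor_sup_conductor_eq_top hT V.2 (hE.mem_toFinset.1 hV).1.symm x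
  obtain ⟨m, hm, n, hn, hmn⟩ := Submodule.mem_sup.1 (hsup.ge (Submodule.mem_top (x := 1)))
  refine ⟨m * x, mem_conductor.1 hm, n * x, Subring.mem_sInf.2 fun V hV => ?_, ?_⟩
  · by_cases hxV : x ∈ V
    · exact V.mul_mem ((h.flat V hV.1).1 n.2) hxV
    · exact mem_conductor.1 <| Submodule.mem_finsetInf.1 (Ideal.prod_le_inf hn) ⟨V, hV.1⟩
        (hE.mem_toFinset.2 ⟨hV.2, hxV⟩)
  · have hval : (m : K) + n = 1 := congrArg Subtype.val hmn
    rw [← add_mul, hval, one_mul]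

theorem IsJaffardOverring.exists_isComplement (h : IsJaffardOverring A T) :
    ∃ V, IsComplement A T V := by
  obtain ⟨Ψ, hΨ, hT⟩ := h
  have hfam := hΨ.independent.isFlatFamily hΨ.flat hΨ.complete
  refine ⟨sInf (Ψ \ {T}), le_antisymm (fun x hx => hfam.mem_of_forall_mem fun V hV => ?_) ?_,
    hfam.exists_mem_add_mem_sInf hΨ.locallyFinite hT⟩
  · obtain rfl | hVT := eq_or_ne V T
    · exact hx.1
    · exact Subring.mem_sInf.1 hx.2 V ⟨hV, hVT⟩
  · exact le_inf (hΨ.flat T hT).1 (le_sInf fun V hV => (hΨ.flat V hV.1).1)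

theorem IsComplement.le_of_isFlatOverring (h : IsComplement A T V) (hS : IsFlatOverring A S)
    (hST : S ⊔ T = ⊤) : V ≤ S := fun v hv => by
  have hAT : A ≤ T := h.inf_eq ▸ inf_le_left
  have hAV : A ≤ V := h.inf_eq ▸ inf_le_right
  exact (hS.spansOne_conductor_of_sup_eq_top hAT hST v).mem_subring fun a ha =>
    hS.1 (h.inf_eq.le ⟨mem_conductor.1 ha, V.mul_mem (hAV a.2) hv⟩)

theorem IsComplement.spansOne_conductor (h : IsComplement A T V) (hAT : A ≤ T) (hVS : V ≤ S)
    (x : K) : SpansOne (conductor hAT x) S := by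
  obtain ⟨b, hb0, hbx⟩ := exists_mul_mem (A := A) x
  have hb0' : (b : K) ≠ 0 := Subtype.coe_ne_coe.2 hb0
  have hAV : A ≤ V := h.inf_eq ▸ inf_le_right
  obtain ⟨t, ht, v, hv, htv⟩ := h.exists_add_eq (b : K)⁻¹
  have hone : (b : K) * t + b * v = 1 := by rw [← mul_add, htv, mul_inv_cancel₀ hb0']
  have hbt : (b : K) * t ∈ A := by
    refine h.inf_eq.le ⟨T.mul_mem (hAT b.2) ht, ?_⟩
    rw [eq_sub_of_add_eq hone]
    exact V.sub_mem V.one_mem (V.mul_mem (hAV b.2) hv)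
  have hbt_mem : (⟨b * t, hbt⟩ : A) ∈ conductor hAT x := mem_conductor.2 <| by
    have hcomm : (b : K) * t * x = t * (b * x) := by ring
    exact hcomm ▸ T.mul_mem ht (hAT hbx)
  have hb_mem : b ∈ conductor hAT x := mem_conductor.2 (hAT hbx)
  rw [SpansOne, ← hone, mul_comm (b : K) v]
  exact add_mem (Submodule.subset_span ⟨_, hbt_mem, rfl⟩)
    (Submodule.smul_mem _ (⟨v, hVS hv⟩ : S) (Submodule.subset_span ⟨_, hb_mem, rfl⟩))

end Complement

section CompactFamily

variable {K : Type u} [Field K] {A T : Subring K} {Θ : Set (Subring K)}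
  {U : Ultrafilter (Subring K)}

/-- The ring of the elements of `K` that belong to `U`-almost all subrings. The ultrafilter `U`
converges to `T` in the Zariski topology if and only if `T ≤ limitRing U`. -/
def limitRing (U : Ultrafilter (Subring K)) : Subring K where
  carrier := {x | ∀ᶠ S : Subring K in U, x ∈ S}
  mul_mem' hx hy := (hx.and hy).mono fun S hS => S.mul_mem hS.1 hS.2
  add_mem' hx hy := (hx.and hy).mono fun S hS => S.add_mem hS.1 hS.2
  one_mem' := Filter.Eventually.of_forall fun S => S.one_mem
  zero_mem' := Filter.Eventually.of_forall fun S => S.zero_mem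
  neg_mem' hx := hx.mono fun S hS => S.neg_mem hS

theorem eventually_mem_span {X : Set K} {y : K} (hy : y ∈ Submodule.span T X)
    (hT : T ≤ limitRing U) : ∀ᶠ S : Subring K in U, y ∈ Submodule.span S X := by
  induction hy using Submodule.span_induction with
  | mem x hx => exact Filter.Eventually.of_forall fun S => Submodule.subset_span hx
  | zero => exact Filter.Eventually.of_forall fun S => zero_mem _
  | add x y _ _ hx hy => exact (hx.and hy).mono fun S hS => add_mem hS.1 hS.2
  | smul t x _ hx =>
    filter_upwards [hT t.2, hx] with S ht hx
    exact Submodule.smul_mem _ (⟨t, ht⟩ : S) hx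

theorem SpansOne.eventually {I : Ideal A} (hI : SpansOne I T) (hT : T ≤ limitRing U) :
    ∀ᶠ S : Subring K in U, SpansOne I S :=
  eventually_mem_span hI hT

/-- A flat family that is compact in the Zariski topology. -/
structure IsCompactFamily (A : Subring K) (Θ : Set (Subring K)) : Prop
    extends IsFlatFamily A Θ where
  compact : ∀ U : Ultrafilter (Subring K), (∀ᶠ S in U, S ∈ Θ) → ∃ T ∈ Θ, T ≤ limitRing U

theorem IsPreJaffardFamily.isCompactFamily [IsFractionRing A K] (h : IsPreJaffardFamily A Θ) :
    IsCompactFamily A Θ where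
  toIsFlatFamily := h.independent.isFlatFamily h.flat h.complete
  compact U hU := by
    let := zariskiTopology K
    obtain ⟨T, hT, hUT⟩ := isCompact_iff_ultrafilter_le_nhds'.1 h.compact U hU
    refine ⟨T, hT, fun x hx => hUT (IsOpen.mem_nhds ?_ hx)⟩
    exact TopologicalSpace.isOpen_generateFrom_of_mem ⟨{x}, by simp⟩

end CompactFamily

section Complemented

variable {K : Type u} [Field K] {A T V : Subring K} {Θ Ψ : Set (Subring K)}
  {U : Ultrafilter (Subring K)} [IsFractionRing A K]

theorem IsFlatFamily.limitRing_eq_top (h : IsFlatFamily A Θ) (hT : T ∈ Θ)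
    (hTV : IsComplement A T V) (hU : ∀ᶠ S in U, S ∈ Θ ∧ S ≠ T) (hTU : T ≤ limitRing U) :
    limitRing U = ⊤ := by
  have hVU : V ≤ limitRing U := fun v hv => hU.mono fun S hS =>
    hTV.le_of_isFlatOverring (h.flat S hS.1) (h.sup_eq_top S hS.1 T hT hS.2) hv
  exact eq_top_iff.2 (hTV.sup_eq_top ▸ sup_le hTU hVU)

theorem IsCompactFamily.finite_not_spansOne (h : IsCompactFamily A Θ)
    (hs : ∀ T ∈ Θ, T ∉ Ψ → ∃ V, IsComplement A T V) {I : Ideal A} (hI : I ≠ ⊥)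
    (hIΨ : ∀ T ∈ Ψ, SpansOne I T) : {T ∈ Θ | ¬ SpansOne I T}.Finite := by
  by_contra hinf
  have := (Set.not_finite.1 hinf).cofinite_inf_principal_neBot
  let U := Ultrafilter.of (Filter.cofinite ⊓ Filter.principal {T ∈ Θ | ¬ SpansOne I T})
  have hne (T) : ∀ᶠ S : Subring K in U, S ≠ T :=
    Ultrafilter.of_le _ (Filter.mem_inf_of_left (Set.finite_singleton T).compl_mem_cofinite)
  have hU : ∀ᶠ S : Subring K in U, S ∈ Θ ∧ ¬ SpansOne I S :=
    Ultrafilter.of_le _ (Filter.mem_inf_of_right (Filter.mem_principal_self _))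
  have not_spansOne_of_le {T : Subring K} (hTU : T ≤ limitRing U) : ¬ SpansOne I T := fun hT => by
    obtain ⟨S, hS, hS'⟩ := (hU.and (hT.eventually hTU)).exists
    exact hS.2 hS'
  obtain ⟨T, hT, hTU⟩ := h.compact U (hU.mono fun S hS => hS.1)
  obtain ⟨V, hTV⟩ := hs T hT fun hTΨ => not_spansOne_of_le hTU (hIΨ T hTΨ)
  have htop := h.limitRing_eq_top hT hTV ((hU.and (hne T)).mono fun S hS => ⟨hS.1.1, hS.2⟩) hTU
  exact not_spansOne_of_le htop.ge (spansOne_top hI)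

theorem IsCompactFamily.mem_of_forall_saturation_mem (h : IsCompactFamily A Θ)
    (hs : ∀ T ∈ Θ, T ∉ Ψ → ∃ V, IsComplement A T V) (F : GabrielFilter A) {I : Ideal A}
    (hI : I ≠ ⊥) (hIΨ : ∀ T ∈ Ψ, SpansOne I T)
    (hF : ∀ T (hT : A ≤ T), T ∈ Θ \ Ψ → saturation (Subring.inclusion hT) I ∈ F) : I ∈ F := by
  let E := {T ∈ Θ | ¬ SpansOne I T}
  have : Finite E := h.finite_not_spansOne hs hI hIΨ
  have := Fintype.ofFinite E
  let J (T : E) : Ideal A := saturation (Subring.inclusion (h.flat T T.2.1).1) I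
  have hJ : Finset.univ.inf J ∈ F := F.finset_inf_mem fun T _ =>
    hF T _ ⟨T.2.1, fun hT => T.2.2 (hIΨ T hT)⟩
  refine F.mono hJ fun a ha => h.mem_of_forall_mem_saturation hI fun T hT => ?_
  by_cases hIT : SpansOne I T
  · rw [saturation, (spansOne_iff_map_eq_top _).1 hIT]
    trivial
  · exact Finset.inf_le (f := J) (Finset.mem_univ ⟨T, hT, hIT⟩) ha

theorem IsFlatFamily.exists_isComplement_le_sInf (h : IsFlatFamily A Θ) (hΨ : Ψ ⊆ Θ) (hT : T ∈ Θ)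
    (hTΨ : T ∉ Ψ) (hs : ∃ V, IsComplement A T V) : ∃ V, IsComplement A T V ∧ V ≤ sInf Ψ := by
  obtain ⟨V, hV⟩ := hs
  refine ⟨V, hV, le_sInf fun S hS => hV.le_of_isFlatOverring (h.flat S (hΨ hS)) ?_⟩
  exact h.sup_eq_top S (hΨ hS) T hT fun hST => hTΨ (hST ▸ hS)

theorem IsCompactFamily.spansOne_sInf (h : IsCompactFamily A Θ) (hΨ : Ψ ⊆ Θ)
    (hs : ∀ T ∈ Θ, T ∉ Ψ → ∃ V, IsComplement A T V) {I : Ideal A} (hI : I ≠ ⊥)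
    (hIΨ : ∀ T ∈ Ψ, SpansOne I T) : SpansOne I (sInf Ψ) := by
  let F := spanningFilter (h.base_le_sInf hΨ)
  suffices hF : I ∈ F from (mem_spanningFilter _).1 hF
  refine h.mem_of_forall_saturation_mem hs F hI hIΨ fun T hAT hT => (mem_spanningFilter _).2 ?_
  obtain ⟨V, hTV, hV⟩ := h.exists_isComplement_le_sInf hΨ hT.1 hT.2 (hs T hT.1 hT.2)
  exact spansOne_comap_of_spansOne_conductor hAT (hTV.spansOne_conductor hAT hV)
    (map_inclusion_ne_bot hAT hI)

theorem IsFlatFamily.isFlatOverring_sInf (h : IsFlatFamily A Θ) (hΨ : Ψ ⊆ Θ)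
    (hspan : ∀ I : Ideal A, I ≠ ⊥ → (∀ T ∈ Ψ, SpansOne I T) → SpansOne I (sInf Ψ)) :
    IsFlatOverring A (sInf Ψ) :=
  isFlatOverring_of_spansOne_conductor (h.base_le_sInf hΨ) fun x hx =>
    hspan _ (conductor_ne_bot _ x) fun T hT =>
      (h.flat T (hΨ hT)).spansOne_conductor (Subring.mem_sInf.1 hx T hT)

theorem IsFlatFamily.isFlatFamily_sInf (h : IsFlatFamily A Θ) (hΨ : Ψ ⊆ Θ)
    (hspan : ∀ I : Ideal A, I ≠ ⊥ → (∀ T ∈ Ψ, SpansOne I T) → SpansOne I (sInf Ψ)) :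
    IsFlatFamily (sInf Ψ) Ψ where
  flat T hT := (h.flat T (hΨ hT)).of_le (h.base_le_sInf hΨ) (sInf_le hT)
  sup_eq_top S hS T hT := h.sup_eq_top S (hΨ hS) T (hΨ hT)
  complete J hJ hJΨ := by
    have hflat := h.isFlatOverring_sInf hΨ hspan
    refine spansOne_self.1 ((hflat.spansOne_comap_iff le_rfl).1 ?_)
    exact hspan _ (comap_inclusion_ne_bot hflat.1 hJ) fun T hT =>
      (hflat.spansOne_comap_iff (sInf_le hT)).2 (hJΨ T hT)

theorem IsCompactFamily.isCompactFamily_sInf (h : IsCompactFamily A Θ) (hΨ : Ψ ⊆ Θ)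
    (hs : ∀ T ∈ Θ, T ∉ Ψ → ∃ V, IsComplement A T V) : IsCompactFamily (sInf Ψ) Ψ where
  toIsFlatFamily := h.isFlatFamily_sInf hΨ fun _ => h.spansOne_sInf hΨ hs
  compact U hU := by
    obtain ⟨T, hT, hTU⟩ := h.compact U (hU.mono fun S hS => hΨ hS)
    by_cases hTΨ : T ∈ Ψ
    · exact ⟨T, hTΨ, hTU⟩
    · obtain ⟨V, hTV⟩ := hs T hT hTΨ
      obtain ⟨S, hS⟩ := hU.exists
      have htop : limitRing U = ⊤ := h.limitRing_eq_top hT hTV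
        (hU.mono fun S hS => ⟨hΨ hS, fun hST => hTΨ (hST ▸ hS)⟩) hTU
      exact ⟨S, hS, htop ▸ le_top⟩

end Complemented

section Intersection

variable {K : Type u} [Field K] {A T : Subring K} {Θ : Set (Subring K)} {ι : Type*} [Nonempty ι]
  {Ψ : ι → Set (Subring K)}

theorem IsFlatFamily.exists_mem_iInter_le_limitRing (h : IsFlatFamily A Θ) (hΨ : ∀ i, Ψ i ⊆ Θ)
    {U : Ultrafilter (Subring K)} (hc : ∀ i, ∃ T ∈ Ψ i, T ≤ limitRing U) (hU : limitRing U ≠ ⊤) :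
    ∃ T ∈ ⋂ i, Ψ i, T ≤ limitRing U := by
  choose T hT hTU using hc
  let i₀ : ι := Classical.arbitrary ι
  have hconst (i) : T i = T i₀ := by
    by_contra hne
    refine hU (eq_top_iff.2 ?_)
    rw [← h.sup_eq_top _ (hΨ i (hT i)) _ (hΨ i₀ (hT i₀)) hne]
    exact sup_le (hTU i) (hTU i₀)
  exact ⟨T i₀, Set.mem_iInter.2 fun i => hconst i ▸ hT i, hTU i₀⟩

theorem IsFlatFamily.exists_forall_spansOne (h : IsFlatFamily A Θ) (hΨ : ∀ i, Ψ i ⊆ Θ)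
    (hd : Directed (· ⊇ ·) Ψ)
    (hc : ∀ i, ∀ U : Ultrafilter (Subring K), (∀ᶠ S in U, S ∈ Ψ i) → ∃ T ∈ Ψ i, T ≤ limitRing U)
    {I : Ideal A} (hI : I ≠ ⊥) (hIΨ : ∀ T ∈ ⋂ i, Ψ i, SpansOne I T) :
    ∃ i, ∀ T ∈ Ψ i, SpansOne I T := by
  by_contra! H
  let E (i : ι) : Set (Subring K) := Ψ i ∩ {T | ¬ SpansOne I T}
  have hE (i) : (E i).Nonempty := H i
  have hdE : Directed (· ≥ ·) fun i => Filter.principal (E i) := fun i j =>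
    have hmono {k l} (h : Ψ k ⊆ Ψ l) : Filter.principal (E k) ≤ Filter.principal (E l) :=
      Filter.principal_mono.2 (Set.inter_subset_inter_left _ h)
    (hd i j).imp fun _ => And.imp hmono hmono
  have := Filter.iInf_neBot_of_directed' hdE fun i => Filter.principal_neBot_iff.2 (hE i)
  let U := Ultrafilter.of (⨅ i, Filter.principal (E i))
  have hU (i) : ∀ᶠ S : Subring K in U, S ∈ E i :=
    Ultrafilter.of_le _ (Filter.mem_iInf_of_mem i (Filter.mem_principal_self _))
  have not_spansOne_of_le {T : Subring K} (hTU : T ≤ limitRing U) : ¬ SpansOne I T := fun hT => by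
    obtain ⟨S, hS, hS'⟩ := ((hU (Classical.arbitrary ι)).and (hT.eventually hTU)).exists
    exact hS.2 hS'
  obtain ⟨T, hT, hTU⟩ := h.exists_mem_iInter_le_limitRing hΨ
    (fun i => hc i U ((hU i).mono fun S hS => hS.1))
    fun htop => not_spansOne_of_le htop.ge (spansOne_top hI)
  exact not_spansOne_of_le hTU (hIΨ T hT)

end Intersection

section GabrielComplete

variable {K : Type u} [Field K] {A B : Subring K} {Ω Ω' : Set (Subring K)}

/-- Membership in a Gabriel filter of `A` can be checked on the saturations with respect to the
overrings of `A` in `Ω`. -/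
def IsGabrielComplete (A : Subring K) (Ω : Set (Subring K)) : Prop :=
  ∀ (F : GabrielFilter A) (I : Ideal A),
    (∀ T (hT : A ≤ T), T ∈ Ω → saturation (Subring.inclusion hT) I ∈ F) → I ∈ F

theorem isGabrielComplete_self (A : Subring K) : IsGabrielComplete A {A} := fun _ I hI => by
  have hsat : saturation (Subring.inclusion le_rfl) I = I :=
    Ideal.comap_id _ |>.trans (Ideal.map_id I)
  exact hsat ▸ hI A le_rfl rfl

theorem IsGabrielComplete.trans (hAB : A ≤ B) (hA : IsGabrielComplete A (Ω ∪ {B}))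
    (hB : IsGabrielComplete B Ω') : IsGabrielComplete A (Ω ∪ Ω') := fun F I hI => by
  refine hA F I fun T hT hTΩ => ?_
  obtain hTΩ | rfl := hTΩ
  · exact hI T hT (Or.inl hTΩ)
  · refine hB (F.map _ (Subring.inclusion_injective hT)) _ fun S hS hSΩ => ?_
    have hsat : (saturation (Subring.inclusion hS) (I.map (Subring.inclusion hT))).comap
        (Subring.inclusion hT) = saturation (Subring.inclusion (hT.trans hS)) I := by
      rw [saturation, Ideal.map_map]
      rfl
    exact (hsat ▸ hI S (hT.trans hS) (Or.inr hSΩ) :)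

theorem IsFlatOverring.isGabrielComplete [IsFractionRing A K] (hB : IsFlatOverring A B)
    (h : ∀ (F : GabrielFilter A) (I : Ideal A), SpansOne I B →
      (∀ T (hT : A ≤ T), T ∈ Ω → saturation (Subring.inclusion hT) I ∈ F) → I ∈ F) :
    IsGabrielComplete A (Ω ∪ {B}) := fun F _ hI =>
  F.mem_of_forall_colon_mem (hI B hB.1 (Or.inr rfl)) fun _ hy =>
    h F _ (hB.spansOne_colon_of_mem_saturation hy) fun T hT hTΩ =>
      F.mono (hI T hT (Or.inl hTΩ)) (saturation_mono _ Ideal.le_colon)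

end GabrielComplete

section DerivedStage

variable {K : Type u} [Field K] {D B : Subring K} {Θ Ψ Ψ₁ : Set (Subring K)}

/-- The properties of the ring `B = T_α` and of the family `Ψ = Θ_α` that are carried along the
derived sequence of the family `Θ` of overrings of `D`. -/
structure IsDerivedStage (D : Subring K) (Θ : Set (Subring K)) (B : Subring K)
    (Ψ : Set (Subring K)) : Prop where
  subset : Ψ ⊆ Θ
  family : IsCompactFamily B Ψ
  flat : IsFlatOverring D B
  sup_eq_top : ∀ T ∈ Θ, T ∉ Ψ → T ⊔ B = ⊤
  gabrielComplete : IsGabrielComplete D ((Θ \ Ψ) ∪ {B})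

theorem IsCompactFamily.isDerivedStage_self (h : IsCompactFamily D Θ) : IsDerivedStage D Θ D Θ where
  subset := subset_rfl
  family := h
  flat := IsFlatOverring.refl D
  sup_eq_top T hT hT' := absurd hT hT'
  gabrielComplete := by
    rw [sdiff_self, Set.bot_eq_empty, Set.empty_union]
    exact isGabrielComplete_self D

theorem exists_spansOne_of_forall_mem_iInter {ι : Type*} [Nonempty ι] {B : ι → Subring K}
    {Ψ : ι → Set (Subring K)} (h : IsFlatFamily D Θ) (hstage : ∀ i, IsDerivedStage D Θ (B i) (Ψ i))
    (hd : Directed (· ⊇ ·) Ψ) {I : Ideal D} (hI : I ≠ ⊥) (hIΨ : ∀ T ∈ ⋂ i, Ψ i, SpansOne I T) :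
    ∃ i, SpansOne I (B i) := by
  obtain ⟨i, hi⟩ := h.exists_forall_spansOne (fun i => (hstage i).subset) hd
    (fun i => (hstage i).family.compact) hI hIΨ
  exact ⟨i, (hstage i).family.spansOne_base (hstage i).flat.1 hI hi⟩

variable [IsFractionRing D K]

theorem IsDerivedStage.isDerivedStage_sInf (h : IsDerivedStage D Θ B Ψ) (h₁ : Ψ₁ ⊆ Ψ)
    (hs : ∀ T ∈ Ψ, T ∉ Ψ₁ → ∃ V, IsComplement B T V) : IsDerivedStage D Θ (sInf Ψ₁) Ψ₁ := by
  have := isFractionRing_of_le (K := K) h.flat.1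
  have hflat := h.family.isFlatOverring_sInf h₁ fun _ => h.family.spansOne_sInf h₁ hs
  refine ⟨h₁.trans h.subset, h.family.isCompactFamily_sInf h₁ hs, h.flat.trans hflat,
    fun T hT hT₁ => ?_, ?_⟩
  · by_cases hTΨ : T ∈ Ψ
    · obtain ⟨V, hTV, hV⟩ := h.family.exists_isComplement_le_sInf h₁ hTΨ hT₁ (hs T hTΨ hT₁)
      exact eq_top_iff.2 (hTV.sup_eq_top.ge.trans (sup_le_sup_left hV T))
    · exact eq_top_iff.2 ((h.sup_eq_top T hT hTΨ).ge.trans (sup_le_sup_left hflat.1 T))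
  · have hB : IsGabrielComplete B ((Ψ \ Ψ₁) ∪ {sInf Ψ₁}) :=
      hflat.isGabrielComplete fun F _ hI => h.family.mem_of_forall_saturation_mem hs F hI.ne_bot
        fun T hT => hI.of_le (sInf_le hT)
    have hunion := h.gabrielComplete.trans h.flat.1 hB
    rwa [← Set.union_assoc, Set.sdiff_union_sdiff_cancel h.subset h₁] at hunion

theorem isDerivedStage_sInf_iInter {ι : Type*} [Nonempty ι] {B : ι → Subring K}
    {Ψ : ι → Set (Subring K)} (h : IsFlatFamily D Θ) (hstage : ∀ i, IsDerivedStage D Θ (B i) (Ψ i))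
    (hd : Directed (· ⊇ ·) Ψ) : IsDerivedStage D Θ (sInf (⋂ i, Ψ i)) (⋂ i, Ψ i) := by
  have hsub : ⋂ i, Ψ i ⊆ Θ := Set.iInter_subset_of_subset (Classical.arbitrary ι) (hstage _).subset
  have hBle (i) : B i ≤ sInf (⋂ i, Ψ i) := (hstage i).family.base_le_sInf (Set.iInter_subset Ψ i)
  have hspan (I : Ideal D) (hI : I ≠ ⊥) (hIΨ : ∀ T ∈ ⋂ i, Ψ i, SpansOne I T) :
      SpansOne I (sInf (⋂ i, Ψ i)) :=
    (exists_spansOne_of_forall_mem_iInter h hstage hd hI hIΨ).elim fun i hi => hi.of_le (hBle i)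
  have hflat := h.isFlatOverring_sInf hsub hspan
  refine ⟨hsub, ⟨h.isFlatFamily_sInf hsub hspan, fun U hU => ?_⟩, hflat, fun T hT hTΨ => ?_,
    hflat.isGabrielComplete fun F I hI hF => ?_⟩
  · obtain ⟨S, hS⟩ := hU.exists
    by_cases htop : limitRing U = ⊤
    · exact ⟨S, hS, htop ▸ le_top⟩
    · exact h.exists_mem_iInter_le_limitRing (fun i => (hstage i).subset) (fun i =>
        (hstage i).family.compact U (hU.mono fun S hS => Set.mem_iInter.1 hS i)) htop
  · obtain ⟨i, hi⟩ : ∃ i, T ∉ Ψ i := by simpa only [Set.mem_iInter, not_forall] using hTΨ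
    exact eq_top_iff.2 (((hstage i).sup_eq_top T hT hi).ge.trans (sup_le_sup_left (hBle i) T))
  · obtain ⟨i, hi⟩ := exists_spansOne_of_forall_mem_iInter h hstage hd hI.ne_bot fun T hT =>
      hI.of_le (sInf_le hT)
    refine (hstage i).gabrielComplete F I fun T hT hTΩ => ?_
    obtain hTΩ | rfl := hTΩ
    · exact hF T hT ⟨hTΩ.1, fun hTΨ => hTΩ.2 (Set.mem_iInter.1 hTΨ i)⟩
    · rw [saturation, (spansOne_iff_map_eq_top hT).1 hi]
      exact F.top_mem

end DerivedStage

section DerivedSequence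

variable {K : Type u} [Field K] (D : Subring K) (Θ : Set (Subring K))

theorem derivedFamily_zero : derivedFamily D Θ (0 : Ordinal.{v}) = Θ := by
  rw [derivedFamily, derivedPair, Ordinal.limitRecOn_zero]

theorem derivedRing_zero : derivedRing D Θ (0 : Ordinal.{v}) = D := by
  rw [derivedRing, derivedPair, Ordinal.limitRecOn_zero]

theorem derivedFamily_add_one (α : Ordinal.{v}) : derivedFamily D Θ (α + 1) =
    derivedFamily D Θ α \ {T | IsJaffardOverring (derivedRing D Θ α) T} := by
  simp only [derivedFamily, derivedRing, derivedPair, Ordinal.limitRecOn_add_one]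

theorem derivedRing_add_one (α : Ordinal.{v}) :
    derivedRing D Θ (α + 1) = sInf (derivedFamily D Θ (α + 1)) := by
  simp only [derivedFamily, derivedRing, derivedPair, Ordinal.limitRecOn_add_one]

theorem derivedFamily_limit {α : Ordinal.{v}} (hα : Order.IsSuccLimit α) :
    derivedFamily D Θ α = ⋂ β : Set.Iio α, derivedFamily D Θ β.1 := by
  rw [derivedFamily, derivedPair, Ordinal.limitRecOn_limit _ _ _ _ hα, Set.iInter_subtype]
  rfl

theorem derivedRing_limit {α : Ordinal.{v}} (hα : Order.IsSuccLimit α) :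
    derivedRing D Θ α = sInf (derivedFamily D Θ α) := by
  rw [derivedFamily, derivedRing, derivedPair, Ordinal.limitRecOn_limit _ _ _ _ hα]

theorem derivedFamily_antitone : Antitone (derivedFamily D Θ : Ordinal.{v} → _) := by
  intro β α h
  induction α using Ordinal.limitRecOn with
  | zero => rw [nonpos_iff_eq_zero.1 h]
  | add_one γ ih =>
    obtain h | rfl := h.lt_or_eq
    · rw [derivedFamily_add_one]
      exact Set.sdiff_subset.trans (ih (Order.lt_add_one_iff.1 h))
    · exact le_rfl
  | limit γ hγ _ =>
    obtain h | rfl := h.lt_or_eq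
    · rw [derivedFamily_limit D Θ hγ]
      exact Set.iInter_subset_of_subset ⟨β, h⟩ le_rfl
    · exact le_rfl

variable {D Θ} [IsFractionRing D K]

theorem IsCompactFamily.isDerivedStage (h : IsCompactFamily D Θ) (α : Ordinal.{v}) :
    IsDerivedStage D Θ (derivedRing D Θ α) (derivedFamily D Θ α) := by
  induction α using Ordinal.limitRecOn with
  | zero =>
    rw [derivedFamily_zero, derivedRing_zero]
    exact h.isDerivedStage_self
  | add_one γ ih =>
    have := isFractionRing_of_le (K := K) ih.flat.1
    rw [derivedRing_add_one, derivedFamily_add_one]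
    exact ih.isDerivedStage_sInf Set.sdiff_subset fun T hT hT' =>
      IsJaffardOverring.exists_isComplement (not_not.1 fun hJ => hT' ⟨hT, hJ⟩)
  | limit γ hγ ih =>
    have : Nonempty (Set.Iio γ) := ⟨⟨0, hγ.bot_lt⟩⟩
    have hanti : Antitone fun β : Set.Iio γ => derivedFamily D Θ β.1 :=
      (derivedFamily_antitone D Θ).comp_monotone (Subtype.mono_coe _)
    rw [derivedRing_limit D Θ hγ, derivedFamily_limit D Θ hγ]
    exact isDerivedStage_sInf_iInter h.toIsFlatFamily (fun β => ih β.1 β.2) hanti.directed_ge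

theorem IsCompactFamily.isFlatOverring_of_mem_truncation (h : IsCompactFamily D Θ)
    {α : Ordinal.{v}} {T : Subring K} (hT : T ∈ truncation D Θ α) : IsFlatOverring D T := by
  obtain hT | rfl := hT
  · exact h.flat T hT.1
  · exact (h.isDerivedStage α).flat

theorem IsCompactFamily.sup_eq_top_of_mem_truncation (h : IsCompactFamily D Θ) {α : Ordinal.{v}}
    {S T : Subring K} (hS : S ∈ truncation D Θ α) (hT : T ∈ truncation D Θ α) (hST : S ≠ T) :
    S ⊔ T = ⊤ := by
  obtain hS | rfl := hS <;> obtain hT | rfl := hT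
  · exact h.sup_eq_top S hS.1 T hT.1 hST
  · exact (h.isDerivedStage α).sup_eq_top S hS.1 hS.2
  · rw [sup_comm]
    exact (h.isDerivedStage α).sup_eq_top T hT.1 hT.2
  · exact absurd rfl hST

instance (D : Subring K) (Θ : Set (Subring K)) (α : Ordinal.{v}) : Nonempty (truncation D Θ α) :=
  ⟨⟨_, Or.inr rfl⟩⟩

theorem IsPreJaffardFamily.isGabrielDecomposition (hΘ : IsPreJaffardFamily D Θ) (α : Ordinal.{v}) :
    IsGabrielDecomposition fun T : truncation D Θ α =>
      Subring.inclusion (hΘ.le_of_mem_truncation T.2) where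
  injective T := Subring.inclusion_injective _
  flat T := (hΘ.isCompactFamily.isFlatOverring_of_mem_truncation T.2).2
  map_comap T := (hΘ.isCompactFamily.isFlatOverring_of_mem_truncation T.2).map_comap
  map_comap_eq_top S T hST J hJ := by
    have hS := hΘ.isCompactFamily.isFlatOverring_of_mem_truncation S.2
    have hT := hΘ.isCompactFamily.isFlatOverring_of_mem_truncation T.2
    have hsup := hΘ.isCompactFamily.sup_eq_top_of_mem_truncation T.2 S.2
      fun h => hST (Subtype.ext h.symm)
    exact (spansOne_iff_map_eq_top _).1 <| spansOne_comap_of_spansOne_conductor hS.1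
      (hT.spansOne_conductor_of_sup_eq_top hS.1 hsup) hJ
  mem_of_saturation_mem F I hI := (hΘ.isCompactFamily.isDerivedStage α).gabrielComplete F I
    fun T _ hTΘ => hI ⟨T, hTΘ⟩

end DerivedSequence

section Semistar

open IsLocalization (coeSubmodule)

variable {K : Type u} [Field K] {A T : Subring K}

theorem mem_smul_submodule_iff {X : Submodule A K} {c x : K} (hc : c ≠ 0) :
    x ∈ c • X ↔ c⁻¹ * x ∈ X :=
  Set.mem_smul_set_iff_inv_smul_mem₀ hc (X : Set K) x

theorem mem_coeSubmodule_iff {I : Ideal A} {a : A} : (a : K) ∈ coeSubmodule K I ↔ a ∈ I :=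
  Subtype.val_injective.mem_set_image (s := (I : Set A))

theorem coeSubmodule_colon_singleton (X : Submodule A K) {x : K} (hx : x ≠ 0) :
    coeSubmodule K (X.colon {x}) = x⁻¹ • X ⊓ 1 := by
  ext y
  rw [Submodule.mem_inf, mem_smul_submodule_iff (inv_ne_zero hx), inv_inv, mul_comm]
  constructor
  · rintro ⟨a, ha, rfl⟩
    exact ⟨Submodule.mem_colon_singleton.1 ha, Submodule.mem_one.2 ⟨a, rfl⟩⟩
  · rintro ⟨hy, hy1⟩
    obtain ⟨a, rfl⟩ := Submodule.mem_one.1 hy1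
    exact ⟨a, Submodule.mem_colon_singleton.2 hy, rfl⟩

theorem colon_coeSubmodule (I : Ideal A) (y : A) :
    (coeSubmodule K I).colon {(y : K)} = I.colon {y} := by
  ext a
  rw [Submodule.mem_colon_singleton, Submodule.mem_colon_singleton]
  exact mem_coeSubmodule_iff (a := a * y)

theorem colon_smul_submodule (X : Submodule A K) {c : K} (hc : c ≠ 0) (x : K) :
    (c • X).colon {x} = X.colon {c⁻¹ * x} := by
  ext a
  rw [Submodule.mem_colon_singleton, Submodule.mem_colon_singleton, mem_smul_submodule_iff hc,
    mul_smul_comm]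

theorem IsFlatOverring.map_colon [IsFractionRing A K] (h : IsFlatOverring A T) (X : Submodule A K)
    (x : K) : (X.colon {x}).map (Subring.inclusion h.1) = (extend T X).colon {x} := by
  refine le_antisymm (Ideal.map_le_iff_le_comap.2 fun a ha => ?_) fun t ht => ?_
  · exact Submodule.mem_colon_singleton.2
      (Submodule.subset_span (Submodule.mem_colon_singleton.1 ha))
  · have hspan : SpansOne (conductor le_rfl (t : K) ⊓ X.colon {(t : K) * x}) T :=
      (mem_spanningFilter h.1).1 <| GabrielFilter.inf_mem _
        ((mem_spanningFilter h.1).2 (h.spansOne_conductor t.2))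
        ((mem_spanningFilter h.1).2 (h.spansOne_colon (Submodule.mem_colon_singleton.1 ht)))
    refine (mem_map_inclusion h.1).2 (hspan.mem_of_forall_mul_mem fun a ha => ?_)
    refine Submodule.subset_span ⟨⟨a * t, mem_conductor.1 ha.1⟩, ?_, rfl⟩
    have hatx : (a : K) * (t * x) ∈ X := Submodule.mem_colon_singleton.1 ha.2
    refine Submodule.mem_colon_singleton.2 ?_
    change (a : K) * t * x ∈ X
    rwa [mul_assoc]

namespace StableSemistar

variable (s : StableSemistar A)

theorem apply_bot : s ⊥ = ⊥ := by
  simpa only [zero_smul, Submodule.zero_eq_bot] using (s.smul' 0 ⊥).symm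

theorem one_mem_apply_one : (1 : K) ∈ s 1 := s.le_toFun' 1 (Submodule.mem_one.2 ⟨1, map_one _⟩)

theorem mem_apply_iff {X : Submodule A K} {x : K} :
    x ∈ s X ↔ (1 : K) ∈ s (coeSubmodule K (X.colon {x})) := by
  obtain rfl | hx := eq_or_ne x 0
  · rw [Submodule.colon_singleton_zero, IsLocalization.coeSubmodule_top]
    exact iff_of_true (zero_mem _) s.one_mem_apply_one
  · rw [coeSubmodule_colon_singleton X hx, s.inf', ← s.smul', Submodule.mem_inf,
      mem_smul_submodule_iff (inv_ne_zero hx), inv_inv, mul_one, and_iff_left s.one_mem_apply_one]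

/-- The Gabriel filter of a stable semistar operation `s`: it consists of the ideals `I` such that
`I ^ s` contains `1`. -/
def gabrielFilter : GabrielFilter A where
  sets := {I | (1 : K) ∈ s (coeSubmodule K I)}
  top_mem' := by
    change (1 : K) ∈ s (coeSubmodule K ⊤)
    rw [IsLocalization.coeSubmodule_top]
    exact s.one_mem_apply_one
  mono' I J hI h := s.mono' _ _ (IsLocalization.coeSubmodule_mono K h) hI
  gabriel' J hJ I h := by
    have hle : coeSubmodule K J ≤ s (coeSubmodule K I) := by
      rintro _ ⟨y, hy, rfl⟩
      rw [Algebra.linearMap_apply, s.mem_apply_iff]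
      exact (colon_coeSubmodule I y).symm ▸ h y hy
    exact (s.idem' (coeSubmodule K I)).le (s.mono' _ _ hle hJ)
  bot_notMem' h := by
    change (1 : K) ∈ s (coeSubmodule K ⊥) at h
    rw [IsLocalization.coeSubmodule_bot, s.apply_bot] at h
    exact one_ne_zero ((Submodule.mem_bot A).1 h)

theorem mem_apply_iff_colon_mem {X : Submodule A K} {x : K} :
    x ∈ s X ↔ X.colon {x} ∈ s.gabrielFilter :=
  s.mem_apply_iff

end StableSemistar

theorem GabrielFilter.closure_smul (F : GabrielFilter A) (c : K) (X : Submodule A K) :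
    c • F.closure X = F.closure (c • X) := by
  obtain rfl | hc := eq_or_ne c 0
  · rw [zero_smul, zero_smul, Submodule.zero_eq_bot, eq_comm, eq_bot_iff]
    intro x hx
    by_contra hx0
    refine F.bot_notMem (F.mono hx fun a ha => ?_)
    have hax : (a : K) * x = 0 := Submodule.mem_colon_singleton.1 ha
    exact Subtype.ext ((mul_eq_zero.1 hax).resolve_right hx0)
  · ext x
    rw [mem_smul_submodule_iff hc, F.mem_closure, F.mem_closure, colon_smul_submodule X hc]

/-- The stable semistar operation `I ↦ {x | (I : x) ∈ F}`. -/
def GabrielFilter.semistar (F : GabrielFilter A) : StableSemistar A where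
  toFun := F.closure
  le_toFun' := F.le_closure
  mono' _ _ := F.closure_mono
  idem' := F.closure_closure
  smul' := F.closure_smul
  inf' := F.closure_inf

variable (A) in
/-- The bijection between stable semistar operations and Gabriel filters. -/
def semistarIso : StableSemistar A ≃o GabrielFilter A where
  toFun := StableSemistar.gabrielFilter
  invFun := GabrielFilter.semistar
  left_inv s := by
    ext X x
    exact s.mem_apply_iff_colon_mem.symm
  right_inv F := by
    ext I
    change (coeSubmodule K I).colon {((1 : A) : K)} ∈ F ↔ I ∈ F
    rw [colon_coeSubmodule, colon_singleton_one]
  map_rel_iff' {s t} := ⟨fun h _ _ hx => t.mem_apply_iff.2 (h (s.mem_apply_iff.1 hx)),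
    fun h _ hI => h _ hI⟩

end Semistar

section SemistarDecomposition

variable {K : Type u} [Field K] {D : Subring K} {ι : Type*} {T : ι → Subring K}
  {hT : ∀ i, D ≤ T i} (h : IsGabrielDecomposition fun i => Subring.inclusion (hT i))

include h

theorem IsGabrielDecomposition.map_colon [IsFractionRing D K] (i : ι) (I : Submodule D K) (x : K) :
    (I.colon {x}).map (Subring.inclusion (hT i)) = (extend (T i) I).colon {x} :=
  IsFlatOverring.map_colon ⟨hT i, h.flat i⟩ I x

theorem IsGabrielDecomposition.semistar_apply_eq_iInf [IsFractionRing D K] (s : StableSemistar D)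
    (I : Submodule D K) : s I = ⨅ i, s (restrict (hT i) (extend (T i) I)) := by
  refine le_antisymm (le_iInf fun i => s.mono' _ _ Submodule.subset_span) fun x hx => ?_
  refine s.mem_apply_iff_colon_mem.2 (h.mem_of_saturation_mem _ _ fun i => ?_)
  have hxi := s.mem_apply_iff_colon_mem.1 ((Submodule.mem_iInf _).1 hx i)
  rw [saturation, h.map_colon]
  exact hxi

variable [Nonempty ι]

/-- The isomorphism `Stab(D) ≃ ∏ᵢ Stab(Tᵢ)` given by restriction and extension. -/
def IsGabrielDecomposition.stableSemistarIso :
    StableSemistar D ≃o ∀ i, StableSemistar (T i) :=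
  (semistarIso D).trans <| h.gabrielIso.trans <| orderIsoPiCongrRight fun i =>
    (semistarIso (T i)).symm

theorem IsGabrielDecomposition.restrict_stableSemistarIso (s : StableSemistar D) (i : ι)
    (J : Submodule (T i) K) :
    restrict (hT i) (h.stableSemistarIso s i J) = s (restrict (hT i) J) := by
  ext x
  rw [s.mem_apply_iff_colon_mem]
  exact Iff.rfl

theorem IsGabrielDecomposition.stableSemistarIso_symm_apply [IsFractionRing D K]
    (t : ∀ i, StableSemistar (T i)) (I : Submodule D K) :
    h.stableSemistarIso.symm t I = ⨅ i, restrict (hT i) (t i (extend (T i) I)) := by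
  ext x
  rw [Submodule.mem_iInf]
  refine forall_congr' fun i => ?_
  change (I.colon {x}).map (Subring.inclusion (hT i)) ∈ (t i).gabrielFilter ↔ _
  rw [h.map_colon]
  exact (t i).mem_apply_iff_colon_mem.symm

end SemistarDecomposition

section Torsion

variable {R : Type*} [CommRing R] {M N P : Type*} [AddCommGroup M] [Module R M] [AddCommGroup N]
  [Module R N] [AddCommGroup P] [Module R P]

theorem torsionOf_le_torsionOf_map (f : M →ₗ[R] N) (m : M) :
    Ideal.torsionOf R M m ≤ Ideal.torsionOf R N (f m) := fun a ha => by
  rw [Ideal.mem_torsionOf_iff] at ha ⊢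
  rw [← map_smul, ha, map_zero]

theorem torsionOf_map_of_injective {f : M →ₗ[R] N} (hf : Function.Injective f) (m : M) :
    Ideal.torsionOf R N (f m) = Ideal.torsionOf R M m := by
  ext a
  rw [Ideal.mem_torsionOf_iff, Ideal.mem_torsionOf_iff, ← map_smul, map_eq_zero_iff f hf]

theorem colon_bot_singleton (m : M) : (⊥ : Submodule R M).colon {m} = Ideal.torsionOf R M m := by
  ext a
  rw [Submodule.mem_colon_singleton, Submodule.mem_bot, Ideal.mem_torsionOf_iff]

theorem torsionOf_quotient_mk (I : Ideal R) (r : R) :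
    Ideal.torsionOf R (R ⧸ I) (Submodule.Quotient.mk r) = I.colon {r} := by
  ext a
  rw [Ideal.mem_torsionOf_iff, Submodule.mem_colon_singleton, ← Submodule.Quotient.mk_smul,
    Submodule.Quotient.mk_eq_zero]

namespace GabrielFilter

variable (F : GabrielFilter R)

variable (M) in
/-- The module `M` is torsion with respect to `F`: the annihilators of its elements belong to
`F`. -/
def IsTorsion : Prop :=
  ∀ m : M, Ideal.torsionOf R M m ∈ F

theorem torsionOf_mem_iff {m : M} :
    Ideal.torsionOf R M m ∈ F ↔ m ∈ F.closure (⊥ : Submodule R M) := by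
  rw [mem_closure, colon_bot_singleton]

theorem isTorsion_iff_of_span_eq_top {s : Set M} (hs : Submodule.span R s = ⊤) :
    F.IsTorsion M ↔ ∀ m ∈ s, Ideal.torsionOf R M m ∈ F := by
  refine ⟨fun h m _ => h m, fun h m => F.torsionOf_mem_iff.2 ?_⟩
  have hle : Submodule.span R s ≤ F.closure ⊥ :=
    Submodule.span_le.2 fun m hm => F.torsionOf_mem_iff.1 (h m hm)
  exact hle (hs ▸ Submodule.mem_top)

variable {F} in
theorem IsTorsion.of_injective (h : F.IsTorsion N) {f : M →ₗ[R] N} (hf : Function.Injective f) :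
    F.IsTorsion M :=
  fun m => torsionOf_map_of_injective hf m ▸ h (f m)

variable {F} in
theorem IsTorsion.of_surjective (h : F.IsTorsion M) {f : M →ₗ[R] N}
    (hf : Function.Surjective f) : F.IsTorsion N :=
  hf.forall.2 fun m => F.mono (h m) (torsionOf_le_torsionOf_map f m)

theorem isTorsion_iff_of_exact {f : M →ₗ[R] N} {g : N →ₗ[R] P} (hf : Function.Injective f)
    (hg : Function.Surjective g) (hfg : Function.Exact f g) :
    F.IsTorsion N ↔ F.IsTorsion M ∧ F.IsTorsion P := by
  refine ⟨fun h => ⟨h.of_injective hf, h.of_surjective hg⟩, fun ⟨hM, hP⟩ n => ?_⟩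
  refine F.torsionOf_mem_iff.2 (F.mem_closure_of_forall_smul_mem (hP (g n)) fun a ha => ?_)
  rw [Ideal.mem_torsionOf_iff, ← map_smul] at ha
  obtain ⟨m, hm⟩ := (hfg _).1 ha
  rw [← hm, ← F.torsionOf_mem_iff, torsionOf_map_of_injective hf]
  exact hM m

theorem isTorsion_of_subsingleton [Subsingleton M] : F.IsTorsion M := fun m => by
  rw [Subsingleton.elim m 0, Ideal.torsionOf_zero]
  exact F.top_mem

theorem isTorsion_quotient_iff (I : Ideal R) : F.IsTorsion (R ⧸ I) ↔ I ∈ F := by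
  refine ⟨fun h => ?_, fun h => (Submodule.Quotient.mk_surjective I).forall.2 fun r => ?_⟩
  · rw [← colon_singleton_one I, ← torsionOf_quotient_mk]
    exact h _
  · rw [torsionOf_quotient_mk]
    exact F.mono h Ideal.le_colon

theorem isTorsion_span_singleton_iff {m : M} :
    F.IsTorsion (Submodule.span R {m}) ↔ Ideal.torsionOf R M m ∈ F := by
  let e := Ideal.quotTorsionOfEquivSpanSingleton R M m
  rw [← F.isTorsion_quotient_iff]
  exact ⟨fun h => h.of_injective (f := e.toLinearMap) e.injective,
    fun h => h.of_surjective (f := e.toLinearMap) e.surjective⟩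

end GabrielFilter

end Torsion

section Tensor

open TensorProduct

variable {R S M : Type*} [CommRing R] [CommRing S] [Algebra R S] [AddCommGroup M] [Module R M]

theorem torsionOf_one_tmul [Module.Flat R S] (m : M) :
    Ideal.torsionOf S (S ⊗[R] M) (1 ⊗ₜ m) = (Ideal.torsionOf R M m).map (algebraMap R S) := by
  refine le_antisymm (fun s hs => ?_) (Ideal.map_le_iff_le_comap.2 fun a ha => ?_)
  · rw [Ideal.mem_torsionOf_iff, smul_tmul', smul_eq_mul, mul_one] at hs
    set I := Ideal.torsionOf R M m
    let f : (R ⧸ I) →ₗ[R] M :=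
      (Submodule.span R {m}).subtype ∘ₗ (Ideal.quotTorsionOfEquivSpanSingleton R M m).toLinearMap
    have hf : Function.Injective f :=
      (Submodule.subtype_injective _).comp (Ideal.quotTorsionOfEquivSpanSingleton R M m).injective
    have hf1 : f (Submodule.Quotient.mk 1) = m := one_smul R m
    have hs1 : s ⊗ₜ[R] (Submodule.Quotient.mk 1 : R ⧸ I) = 0 :=
      Module.Flat.lTensor_preserves_injective_linearMap f hf <| by
        rw [LinearMap.lTensor_tmul, hf1, hs, map_zero]
    have hsI : (Submodule.Quotient.mk ((1 : R) • s) : S ⧸ (I • ⊤ : Submodule R S)) = 0 := by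
      rw [← map_zero (tensorQuotEquivQuotSMul S I), ← hs1]
      exact (tensorQuotEquivQuotSMul_tmul_mk I s 1).symm
    rwa [one_smul, Submodule.Quotient.mk_eq_zero, Ideal.smul_top_eq_map] at hsI
  · rw [Ideal.mem_torsionOf_iff] at ha
    rw [Ideal.mem_comap, Ideal.mem_torsionOf_iff, algebraMap_smul, ← tmul_smul, ha, tmul_zero]

theorem span_range_one_tmul : Submodule.span S (Set.range fun m : M => (1 : S) ⊗ₜ[R] m) = ⊤ := by
  rw [← Submodule.baseChange_top (R := R) (M := M) S, Submodule.baseChange_eq_span]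
  congr 1
  ext; simp

theorem GabrielFilter.isTorsion_tensorProduct_iff [Module.Flat R S] (G : GabrielFilter S) :
    G.IsTorsion (S ⊗[R] M) ↔ ∀ m : M, (Ideal.torsionOf R M m).map (algebraMap R S) ∈ G := by
  rw [G.isTorsion_iff_of_span_eq_top (span_range_one_tmul (R := R)), Set.forall_mem_range]
  simp only [torsionOf_one_tmul]

end Tensor

section ChangeOfRings

variable {R S : Type u} [CommRing R] [CommRing S] {φ : R →+* S}

theorem GabrielFilter.isTorsion_extendScalars_iff (hφ : φ.Flat) (G : GabrielFilter S)
    (M : ModuleCat.{u} R) :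
    G.IsTorsion ((ModuleCat.extendScalars φ).obj M) ↔ (G.comap φ).IsTorsion M := by
  algebraize [φ]
  exact G.isTorsion_tensorProduct_iff (R := R)

theorem GabrielFilter.isTorsion_restrictScalars_iff (hφ : Function.Injective φ)
    (F : GabrielFilter R) (M : ModuleCat.{u} S) :
    F.IsTorsion ((ModuleCat.restrictScalars φ).obj M) ↔ (F.map φ hφ).IsTorsion M :=
  Iff.rfl

end ChangeOfRings

section Length

open CategoryTheory

variable {R : Type u} [CommRing R]

namespace LengthFunction

variable (ℓ : LengthFunction R)

section

variable {M N P : Type u} [AddCommGroup M] [Module R M] [AddCommGroup N] [Module R N]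
  [AddCommGroup P] [Module R P]

theorem eq_add_of_exact {f : M →ₗ[R] N} {g : N →ₗ[R] P} (hf : Function.Injective f)
    (hg : Function.Surjective g) (hfg : Function.Exact f g) :
    ℓ (ModuleCat.of R N) = ℓ (ModuleCat.of R M) + ℓ (ModuleCat.of R P) :=
  ℓ.additive' (ShortComplex.mk (ModuleCat.ofHom f) (ModuleCat.ofHom g)
      (ModuleCat.hom_ext hfg.linearMap_comp_eq_zero))
    (ModuleCat.shortComplex_shortExact _ hfg hf hg)

theorem eq_zero_of_injective {f : M →ₗ[R] N} (hf : Function.Injective f)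
    (h : ℓ (ModuleCat.of R N) = 0) : ℓ (ModuleCat.of R M) = 0 := by
  rw [ℓ.eq_add_of_exact hf (Submodule.mkQ_surjective (LinearMap.range f))
    (LinearMap.exact_map_mkQ_range f)] at h
  exact (add_eq_zero.1 h).1

theorem eq_zero_of_surjective {f : M →ₗ[R] N} (hf : Function.Surjective f)
    (h : ℓ (ModuleCat.of R M) = 0) : ℓ (ModuleCat.of R N) = 0 := by
  rw [ℓ.eq_add_of_exact (LinearMap.ker f).injective_subtype hf
    (LinearMap.exact_subtype_ker_map f)] at h
  exact (add_eq_zero.1 h).2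

theorem eq_zero_sup {N₁ N₂ : Submodule R M} (h₁ : ℓ (ModuleCat.of R N₁) = 0)
    (h₂ : ℓ (ModuleCat.of R N₂) = 0) : ℓ (ModuleCat.of R ↥(N₁ ⊔ N₂)) = 0 := by
  have hprod : ℓ (ModuleCat.of R (N₁ × N₂)) = 0 := by
    rw [ℓ.eq_add_of_exact (f := LinearMap.inl R N₁ N₂) (g := LinearMap.snd R N₁ N₂)
      LinearMap.inl_injective LinearMap.snd_surjective Function.Exact.inl_snd, h₁, h₂, add_zero]
  refine ℓ.eq_zero_of_surjective (f := LinearMap.coprod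
    (Submodule.inclusion (le_sup_left : N₁ ≤ N₁ ⊔ N₂))
    (Submodule.inclusion (le_sup_right : N₂ ≤ N₁ ⊔ N₂))) ?_ hprod
  rintro ⟨x, hx⟩
  obtain ⟨y, hy, z, hz, rfl⟩ := Submodule.mem_sup.1 hx
  exact ⟨(⟨y, hy⟩, ⟨z, hz⟩), rfl⟩

theorem quotient_eq_zero_mono {I J : Ideal R} (h : I ≤ J)
    (hI : ℓ (ModuleCat.of R (R ⧸ I)) = 0) : ℓ (ModuleCat.of R (R ⧸ J)) = 0 :=
  ℓ.eq_zero_of_surjective (f := Submodule.factor h) (Submodule.factor_surjective h) hI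

end

theorem eq_zero_iff_forall_torsionOf (M : ModuleCat.{u} R) :
    ℓ M = 0 ↔ ∀ m : M, ℓ (ModuleCat.of R (R ⧸ Ideal.torsionOf R M m)) = 0 := by
  have hspan (m : M) : ℓ (ModuleCat.of R (R ⧸ Ideal.torsionOf R M m)) = 0 ↔
      ℓ (ModuleCat.of R (Submodule.span R {m})) = 0 := by
    let e := Ideal.quotTorsionOfEquivSpanSingleton R M m
    exact ⟨ℓ.eq_zero_of_surjective (f := e.toLinearMap) e.surjective,
      ℓ.eq_zero_of_injective (f := e.toLinearMap) e.injective⟩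
  simp only [hspan]
  refine ⟨fun h m => ℓ.eq_zero_of_injective (Submodule.injective_subtype _) h, fun h => ?_⟩
  rw [ℓ.upperContinuous', ENNReal.iSup_eq_zero]
  rintro ⟨N, hN⟩
  induction N, hN using Submodule.fg_induction with
  | singleton m => exact h m
  | sup N₁ N₂ _ _ h₁ h₂ => exact ℓ.eq_zero_sup h₁ h₂

/-- The Gabriel filter of a nonzero length function `ℓ`: it consists of the ideals `I` with
`ℓ (R / I) = 0`. -/
def gabrielFilter (hℓ : ∃ M, ℓ M ≠ 0) : GabrielFilter R where
  sets := {I | ℓ (ModuleCat.of R (R ⧸ I)) = 0}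
  top_mem' := ℓ.zero' _ (Submodule.Quotient.subsingleton_iff.2 rfl)
  mono' _ _ hI h := ℓ.quotient_eq_zero_mono h hI
  gabriel' J hJ I h := by
    let N : Submodule R (R ⧸ I) := Submodule.map (Submodule.mkQ I) J
    have hN : ℓ (ModuleCat.of R N) = 0 := by
      refine (ℓ.eq_zero_iff_forall_torsionOf _).2 ?_
      rintro ⟨_, y, hy, rfl⟩
      have htors : Ideal.torsionOf R N ⟨Submodule.mkQ I y, y, hy, rfl⟩ =
          I.colon {y} := by
        rw [← torsionOf_map_of_injective N.injective_subtype]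
        exact torsionOf_quotient_mk I y
      exact htors ▸ h y hy
    have hquot : ℓ (ModuleCat.of R ((R ⧸ I) ⧸ N)) = 0 := by
      refine ℓ.eq_zero_of_surjective (f := Submodule.mapQ J N (Submodule.mkQ I)
        (Submodule.le_comap_map _ _)) (Function.Surjective.of_comp (g := Submodule.mkQ J) ?_) hJ
      exact (Submodule.mkQ_surjective N).comp (Submodule.mkQ_surjective I)
    exact (ℓ.eq_add_of_exact N.injective_subtype N.mkQ_surjective
      (LinearMap.exact_subtype_mkQ N)).trans (by rw [hN, hquot, add_zero])
  bot_notMem' h := by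
    obtain ⟨M, hM⟩ := hℓ
    exact hM ((ℓ.eq_zero_iff_forall_torsionOf M).2 fun m => ℓ.quotient_eq_zero_mono bot_le h)

theorem eq_zero_iff_isTorsion (hℓ : ∃ M, ℓ M ≠ 0) (M : ModuleCat.{u} R) :
    ℓ M = 0 ↔ (ℓ.gabrielFilter hℓ).IsTorsion M :=
  ℓ.eq_zero_iff_forall_torsionOf M

end LengthFunction

namespace GabrielFilter

variable (F : GabrielFilter R)

open Classical in
/-- The singular length function that vanishes exactly on the `F`-torsion modules. -/
def length : LengthFunction R where
  toFun M := if F.IsTorsion M then 0 else ∞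
  zero' M _ := if_pos F.isTorsion_of_subsingleton
  additive' S hS := by
    have htors := F.isTorsion_iff_of_exact hS.moduleCat_injective_f hS.moduleCat_surjective_g
      ((ShortComplex.ShortExact.moduleCat_exact_iff_function_exact S).1 hS.exact)
    by_cases h₁ : F.IsTorsion S.X₁ <;> by_cases h₃ : F.IsTorsion S.X₃ <;> simp [htors, h₁, h₃]
  upperContinuous' M := by
    by_cases h : F.IsTorsion M
    · rw [if_pos h, eq_comm, ENNReal.iSup_eq_zero]
      exact fun N => if_pos (h.of_injective N.1.injective_subtype)
    · obtain ⟨m, hm⟩ := not_forall.1 h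
      rw [if_neg h, eq_comm, eq_top_iff]
      refine le_iSup_of_le ⟨Submodule.span R {m}, Submodule.fg_span_singleton m⟩ ?_
      exact (if_neg fun h' => hm (F.isTorsion_span_singleton_iff.1 h')).ge

open Classical in
theorem length_eq_zero_iff {M : ModuleCat.{u} R} : F.length M = 0 ↔ F.IsTorsion M :=
  ite_eq_left_iff.trans <| by simp

open Classical in
theorem length_isSingular : F.length.IsSingular := fun _ => ite_eq_or_eq _ _ _

/-- The length function `F.length` as an element of the set of the nonzero singular ones. -/
def singularLength : SingularLength R :=
  ⟨F.length, F.length_isSingular, ModuleCat.of R (R ⧸ (⊥ : Ideal R)), fun h =>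
    F.bot_notMem ((F.isTorsion_quotient_iff ⊥).1 (F.length_eq_zero_iff.1 h))⟩

end GabrielFilter

theorem le_iff_of_eq_zero_or_eq_top {a b : ℝ≥0∞} (hb : b = 0 ∨ b = ∞) :
    a ≤ b ↔ (b = 0 → a = 0) := by
  obtain rfl | rfl := hb <;> simp

theorem eq_of_eq_zero_or_eq_top {a b : ℝ≥0∞} (ha : a = 0 ∨ a = ∞) (hb : b = 0 ∨ b = ∞)
    (h : a = 0 ↔ b = 0) : a = b :=
  le_antisymm ((le_iff_of_eq_zero_or_eq_top hb).2 h.2) ((le_iff_of_eq_zero_or_eq_top ha).2 h.1)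

theorem eq_tsum_of_eq_zero_iff {ι : Type*} {f : ι → ℝ≥0∞} {c : ℝ≥0∞}
    (hf : ∀ i, f i = 0 ∨ f i = ∞) (hc : c = 0 ∨ c = ∞) (h : c = 0 ↔ ∀ i, f i = 0) :
    c = ∑' i, f i := by
  refine eq_of_eq_zero_or_eq_top hc ?_ (h.trans ENNReal.tsum_eq_zero.symm)
  by_cases h0 : ∀ i, f i = 0
  · exact Or.inl (ENNReal.tsum_eq_zero.2 h0)
  · obtain ⟨i, hi⟩ := not_forall.1 h0
    exact Or.inr (ENNReal.tsum_eq_top_of_eq_top ⟨i, (hf i).resolve_left hi⟩)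

namespace SingularLength

/-- The Gabriel filter of the ideals `I` with `ℓ (R / I) = 0`. -/
def gabrielFilter (ℓ : SingularLength R) : GabrielFilter R :=
  ℓ.1.gabrielFilter ℓ.2.2

theorem eq_zero_iff (ℓ : SingularLength R) {M : ModuleCat.{u} R} :
    ℓ.1 M = 0 ↔ ℓ.gabrielFilter.IsTorsion M :=
  ℓ.1.eq_zero_iff_isTorsion ℓ.2.2 M

theorem gabrielFilter_le_iff {ℓ ℓ' : SingularLength R} :
    ℓ'.gabrielFilter ≤ ℓ.gabrielFilter ↔ ℓ ≤ ℓ' := by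
  refine ⟨fun h M => (le_iff_of_eq_zero_or_eq_top (ℓ'.2.1 M)).2 fun h0 => ?_, fun h I hI => ?_⟩
  · rw [eq_zero_iff] at h0 ⊢
    exact fun m => h (h0 m)
  · exact le_antisymm ((h (ModuleCat.of R (R ⧸ I))).trans_eq hI) zero_le

end SingularLength

variable (R) in
/-- The order-reversing bijection between nonzero singular length functions and Gabriel filters. -/
def singularLengthIso : SingularLength R ≃o (GabrielFilter R)ᵒᵈ where
  toFun ℓ := OrderDual.toDual ℓ.gabrielFilter
  invFun F := (OrderDual.ofDual F).singularLength
  left_inv ℓ := by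
    refine Subtype.ext (LengthFunction.ext (funext fun M => ?_))
    exact eq_of_eq_zero_or_eq_top (ℓ.gabrielFilter.length_isSingular M) (ℓ.2.1 M)
      (ℓ.gabrielFilter.length_eq_zero_iff.trans ℓ.eq_zero_iff.symm)
  right_inv F := GabrielFilter.ext <| Set.ext fun I =>
    F.length_eq_zero_iff.trans (F.isTorsion_quotient_iff I)
  map_rel_iff' := SingularLength.gabrielFilter_le_iff

end Length

section LengthDecomposition

variable {R : Type u} [CommRing R] {ι : Type*} {S : ι → Type u} [∀ i, CommRing (S i)]
  {φ : ∀ i, R →+* S i} (h : IsGabrielDecomposition φ)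

include h

theorem IsGabrielDecomposition.length_eq_tsum (ℓ : LengthFunction R) (hℓ : ℓ.IsSingular)
    (M : ModuleCat.{u} R) :
    ℓ M = ∑' i, ℓ ((ModuleCat.restrictScalars (φ i)).obj
      ((ModuleCat.extendScalars (φ i)).obj M)) := by
  refine eq_tsum_of_eq_zero_iff (fun i => hℓ _) (hℓ M) ?_
  by_cases h0 : ∃ M, ℓ M ≠ 0
  · simp only [ℓ.eq_zero_iff_isTorsion h0,
      GabrielFilter.isTorsion_restrictScalars_iff (h.injective _),
      GabrielFilter.isTorsion_extendScalars_iff (h.flat _)]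
    exact ⟨fun hM i m => (ℓ.gabrielFilter h0).mono (hM m) (le_saturation _ _),
      fun hM m => h.mem_of_saturation_mem _ _ fun i => hM i m⟩
  · push Not at h0
    simp only [h0, implies_true]

variable [Nonempty ι]

/-- The isomorphism `ℒ_sing(R) ≃ ∏ᵢ ℒ_sing(Sᵢ)` given by restriction of scalars. -/
def IsGabrielDecomposition.singularLengthPiIso :
    SingularLength R ≃o ∀ i, SingularLength (S i) :=
  (singularLengthIso R).trans <| OrderIso.trans
    (β := ∀ i, (GabrielFilter (S i))ᵒᵈ) h.gabrielIso.dual <|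
    orderIsoPiCongrRight fun i => (singularLengthIso (S i)).symm

theorem IsGabrielDecomposition.singularLengthPiIso_apply (ℓ : SingularLength R) (i : ι)
    (M : ModuleCat.{u} (S i)) :
    (h.singularLengthPiIso ℓ i).1 M = ℓ.1 ((ModuleCat.restrictScalars (φ i)).obj M) := by
  refine eq_of_eq_zero_or_eq_top ((h.singularLengthPiIso ℓ i).2.1 M) (ℓ.2.1 _) ?_
  rw [ℓ.eq_zero_iff, GabrielFilter.isTorsion_restrictScalars_iff (h.injective i)]
  exact GabrielFilter.length_eq_zero_iff _

theorem IsGabrielDecomposition.singularLengthPiIso_symm_apply (l : ∀ i, SingularLength (S i))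
    (M : ModuleCat.{u} R) :
    (h.singularLengthPiIso.symm l).1 M =
      ∑' i, (l i).1 ((ModuleCat.extendScalars (φ i)).obj M) := by
  refine eq_tsum_of_eq_zero_iff (fun i => (l i).2.1 _) ((h.singularLengthPiIso.symm l).2.1 M) ?_
  simp only [(l _).eq_zero_iff, GabrielFilter.isTorsion_extendScalars_iff (h.flat _)]
  exact (GabrielFilter.length_eq_zero_iff _).trans forall_comm

end LengthDecomposition

end PreJaffard

end

theorem mainTheorem2 {K : Type u} [Field K] (D : Subring K) [IsFractionRing D K]
    (Θ : Set (Subring K)) (hΘ : IsPreJaffardFamily D Θ) (α : Ordinal.{v}) :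
    -- `I^⋆ = ⋂_{T ∈ Θ'} (IT)^⋆`
    (∀ (s : StableSemistar D) (I : Submodule D K),
      s I = ⨅ T : truncation D Θ α,
        s (restrict (hΘ.le_of_mem_truncation T.2) (extend T.1 I))) ∧
    -- restriction and extension are inverse order isomorphisms `Stab(D) ≃ ∏ Stab(T)`
    (∃ e : StableSemistar D ≃o ((T : truncation D Θ α) → StableSemistar T.1),
      (∀ (s : StableSemistar D) (T : truncation D Θ α) (J : Submodule T.1 K),
        restrict (hΘ.le_of_mem_truncation T.2) (e s T J) =
          s (restrict (hΘ.le_of_mem_truncation T.2) J)) ∧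
      (∀ (t : (T : truncation D Θ α) → StableSemistar T.1) (I : Submodule D K),
        e.symm t I = ⨅ T : truncation D Θ α,
          restrict (hΘ.le_of_mem_truncation T.2) (t T (extend T.1 I)))) ∧
    -- `ℓ = ∑_{T ∈ Θ'} ℓ ⊗ T` for every singular length function
    (∀ ℓ : LengthFunction D, ℓ.IsSingular → ∀ M : ModuleCat.{u} D,
      ℓ M = ∑' T : truncation D Θ α,
        ℓ (restrictModule (hΘ.le_of_mem_truncation T.2)
          (extendModule (hΘ.le_of_mem_truncation T.2) M))) ∧
    -- restriction and extension are inverse order isomorphisms for singular length functions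
    (∃ e : SingularLength D ≃o ((T : truncation D Θ α) → SingularLength T.1),
      (∀ (ℓ : SingularLength D) (T : truncation D Θ α) (M : ModuleCat.{u} T.1),
        (e ℓ T).1 M = ℓ.1 (restrictModule (hΘ.le_of_mem_truncation T.2) M)) ∧
      (∀ (l : (T : truncation D Θ α) → SingularLength T.1) (M : ModuleCat.{u} D),
        (e.symm l).1 M = ∑' T : truncation D Θ α,
          (l T).1 (extendModule (hΘ.le_of_mem_truncation T.2) M))) := by
  have h := hΘ.isGabrielDecomposition α
  exact ⟨h.semistar_apply_eq_iInf,
    ⟨h.stableSemistarIso, h.restrict_stableSemistarIso, h.stableSemistarIso_symm_apply⟩,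
    h.length_eq_tsum,
    ⟨h.singularLengthPiIso, h.singularLengthPiIso_apply, h.singularLengthPiIso_symm_apply⟩⟩
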